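/- There is a polynomial $\lambda_6$ in four variables, with real coefficients (the same for all dimensions and for all data below), such that the following holds. Let $d\ge 0$ and let $H:\mathbb R^d\to\mathbb R^d$ be a (jointly measurable) random function. Let $L_H, L_H', L_H'', L_\beta\in\mathbb R$ and $L_R>0$ be constants such that, almost surely, $\|H(u)\|\le L_H$ for all $u\in\mathbb R^d$, and, for all $u$ with $\|u\|\le 1/\sqrt{L_R}$, $H$ is twice differentiable at $u$ with $\|\nabla H(u)\|\le L_H'$ and $\|\nabla^2H(u)\|\le L_H''$ (operator norms). Assume that $\mathbb E\,H(z)=0$ and $\mathbb E\,H(z)H(z)^{\mathsf T}=I$ for every $z\in\mathbb R^d$. Let $(H_k)_k$ be independent samples of $H$, let $(\zeta_k)_k$ be independent samples of $\mathcal N(0,I)$, and let $\beta\in\mathbb R^d$ with $\|\beta\|\le L_\beta$. Let $T>0$ satisfy $$T\le\min\Big\{\tfrac{1}{16L_H^2},\ \tfrac{1}{16L_H'^2},\ \tfrac{1}{32\sqrt{L_R}L_\beta},\ \tfrac{1}{128L_RL_H^2},\ \tfrac{1}{256L_RL_H^2\log(2^{10}L_R)}\Big\},$$ where a term is omitted if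 its denominator is not positive, put $\delta:=T^3$ and $K:=T/\delta=T^{-2}$, and assume that $K$ is an integer. Consider the two walks $$\tilde z_{k+1}=\tilde z_k+\delta\beta+\sqrt\delta\,H_k(\tilde z_k),\qquad z_{k+1}=z_k+\delta\beta+\sqrt\delta\,\zeta_{k+1},$$ started at the same deterministic point $\tilde z_0=z_0\in\mathbb R^d$. Then $$W_2(\tilde z_K,z_K)\le\lambda_6(L_H,L_H',L_H'',L_R)\cdot\log\Big(\frac{1}{T L_H^2}\Big)^4\,T^{3/2},$$ where $W_2$ is the Wasserstein distance of order 2 between the laws (with the convention $\log(1/0):=0$, needed only if $d=0$ and $L_H=0$). -/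

import Mathlib

open MeasureTheory ProbabilityTheory
open scoped ENNReal

/-- The couplings of two measures `μ` and `ν`: the measures on the product whose first marginal is
`μ` and whose second marginal is `ν`. -/
def couplings {E : Type*} [MeasurableSpace E] (μ ν : Measure E) : Set (Measure (E × E)) :=
  {γ | γ.map Prod.fst = μ ∧ γ.map Prod.snd = ν}

/-- The Wasserstein distance of order two, with values in `[0, ∞]`: the square root of the infimum
over all couplings `γ` of `∫ ‖x - y‖² dγ(x, y)`. -/
noncomputable def W2 {E : Type*} [NormedAddCommGroup E] [MeasurableSpace E]
    (μ ν : Measure E) : ℝ≥0∞ :=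
  (⨅ γ ∈ couplings μ ν, ∫⁻ p, ‖p.1 - p.2‖ₑ ^ 2 ∂γ) ^ (1 / 2 : ℝ)

/-- The walk `z (k + 1) = z k + δ β + √δ F k (z k)` started at `z 0 = z₀`. -/
noncomputable def walk {E : Type*} [NormedAddCommGroup E] [NormedSpace ℝ E]
    (δ : ℝ) (β z₀ : E) (F : ℕ → E → E) : ℕ → E
  | 0 => z₀
  | k + 1 => walk δ β z₀ F k + δ • β + √δ • F k (walk δ β z₀ F k)

/-! The proof is a Lindeberg replacement. Let `M k` be the law obtained from `k` steps of the random
field followed by `K - k` Gaussian steps. These laws interpolate between the two walks, and by the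
triangle inequality for `W2` it suffices to compare neighbours. Gaussian noise does not depend on
the position, so the trailing steps merge into one Gaussian vector. Only the law of each walk
matters; no joint law of the samples and the Gaussians enters.

Fix the position `z` before the replaced step, let `m` Gaussian steps follow, and put `r = 1 / (m +
1)`. Up to translation and the factor `√((m + 1) δ)`, the comparison is between `√r X + √(1 - r) g`
and `g`, where `X = H(z)` is centred, isotropic and bounded by `b`. The second moment of the
relative density of the first law is computed from Mehler's kernel: it is the mean of an explicit
exponential in two independent copies of `X`. The mean-zero condition kills the term of order `r`,
and the identity covariance makes the terms of order `r ^ 2` cancel against the normalising factor.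
What is left is at most `exp (5 r ^ 3 b ^ 6)` when `r b ^ 2 ≤ 1 / 2` (`lintegral_mixPDF_sq_div_le`).
Hence the relative entropy is at most `5 r ^ 3 b ^ 6`, and Talagrand's inequality (`exists_knothe`)
bounds the squared transport cost by `10 r ^ 3 b ^ 6`. After rescaling, one replacement costs at
most `4 b ^ 3 √δ / (m + 1)`. For the few steps with `m + 1 < 2 b ^ 2` a trivial coupling gives the
same bound (`W2_step_le`).

Summing over `m` gives `4 b ^ 3 √δ` times a harmonic number (`W2_walk_le`). Since `√δ = T ^ (3 / 2)`
and `K = T⁻²`, the harmonic number is logarithmic in `1 / T` and the claim follows.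

Talagrand's inequality is proved from scratch: on the line by monotone rearrangement, then in all
dimensions by induction with the Knothe map. That map is built jointly measurable in a parameter, so
that the couplings for different `z` can be glued together. -/

section

open Set Filter Topology

/-! ### Distribution functions of positive densities on the line. -/

/-- The distribution function of the density `p` on the line. -/
noncomputable def lowerInt (p : ℝ → ℝ) (x : ℝ) : ℝ := ∫ s in Iic x, p s

section LowerInt

variable {p : ℝ → ℝ}

theorem integrable_of_integral_eq_one' {α : Type*} [MeasurableSpace α] {μ : Measure α}
    {f : α → ℝ} (h : ∫ x, f x ∂μ = 1) : Integrable f μ := by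
  by_contra hf
  rw [integral_undef hf] at h
  exact zero_ne_one h

theorem hasDerivAt_lowerInt (hc : Continuous p) (hi : Integrable p) (x : ℝ) :
    HasDerivAt (lowerInt p) (p x) x := by
  have h : lowerInt p = fun y => lowerInt p 0 + ∫ s in (0 : ℝ)..y, p s := by
    funext y
    rw [← intervalIntegral.integral_Iic_sub_Iic hi.integrableOn hi.integrableOn]
    simp [lowerInt]
  rw [h]
  exact (intervalIntegral.integral_hasDerivAt_right (hc.intervalIntegrable _ _)
    (hc.stronglyMeasurableAtFilter _ _) hc.continuousAt).const_add _

theorem strictMono_lowerInt (hc : Continuous p) (hi : Integrable p) (hp : ∀ x, 0 < p x) :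
    StrictMono (lowerInt p) :=
  strictMono_of_hasDerivAt_pos (fun x => hasDerivAt_lowerInt hc hi x) hp

theorem continuous_lowerInt (hc : Continuous p) (hi : Integrable p) : Continuous (lowerInt p) :=
  continuous_iff_continuousAt.2 fun x => (hasDerivAt_lowerInt hc hi x).continuousAt

theorem tendsto_lowerInt_atTop (h1 : ∫ x, p x = 1) : Tendsto (lowerInt p) atTop (𝓝 1) := by
  have hi := integrable_of_integral_eq_one' h1
  rw [← h1]
  exact (aecover_Iic tendsto_id).integral_tendsto_of_countably_generated hi

theorem tendsto_lowerInt_atBot (h1 : ∫ x, p x = 1) : Tendsto (lowerInt p) atBot (𝓝 0) := by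
  have hi := integrable_of_integral_eq_one' h1
  have h2 : Tendsto (fun x => ∫ s in Ioi x, p s) atBot (𝓝 (∫ s, p s)) :=
    (aecover_Ioi tendsto_id).integral_tendsto_of_countably_generated hi
  have h3 : lowerInt p = fun x => 1 - ∫ s in Ioi x, p s := by
    funext x
    have := integral_add_compl (measurableSet_Iic (a := x)) hi
    rw [compl_Iic, h1] at this
    simp only [lowerInt]; linarith
  rw [h3]
  have := h2.const_sub 1
  rwa [h1, sub_self] at this

theorem lowerInt_mem_Ioo (hc : Continuous p) (h1 : ∫ x, p x = 1) (hp : ∀ x, 0 < p x) (x : ℝ) :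
    lowerInt p x ∈ Ioo (0 : ℝ) 1 := by
  have hi := integrable_of_integral_eq_one' h1
  have hm := strictMono_lowerInt hc hi hp
  constructor
  · exact (hm.monotone.le_of_tendsto (tendsto_lowerInt_atBot h1) (x - 1)).trans_lt
      (hm (by linarith))
  · exact (hm (show x < x + 1 by linarith)).trans_le
      (hm.monotone.ge_of_tendsto (tendsto_lowerInt_atTop h1) (x + 1))

theorem exists_lowerInt_eq (hc : Continuous p) (h1 : ∫ x, p x = 1) {u : ℝ}
    (hu : u ∈ Ioo (0 : ℝ) 1) : ∃ x, lowerInt p x = u := by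
  have hi := integrable_of_integral_eq_one' h1
  obtain ⟨a, ha⟩ := ((tendsto_lowerInt_atBot h1).eventually_lt_const hu.1).exists
  obtain ⟨b, hb⟩ := ((tendsto_lowerInt_atTop h1).eventually_const_lt hu.2).exists
  exact mem_range_of_exists_le_of_exists_ge (continuous_lowerInt hc hi) ⟨a, ha.le⟩ ⟨b, hb.le⟩

end LowerInt

/-! ### The standard Gaussian density and its quantile function. -/

section Gaussian

theorem continuous_gaussianPDFReal (m : ℝ) (v : NNReal) : Continuous (gaussianPDFReal m v) := by
  unfold gaussianPDFReal; fun_prop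

theorem gaussianPDFReal_std (x : ℝ) :
    gaussianPDFReal 0 1 x = (√(2 * Real.pi))⁻¹ * Real.exp (-x ^ 2 / 2) := by
  simp [gaussianPDFReal]

theorem hasDerivAt_gaussianPDFReal_std (x : ℝ) :
    HasDerivAt (gaussianPDFReal 0 1) (-x * gaussianPDFReal 0 1 x) x := by
  have h : gaussianPDFReal 0 1 = fun x => (√(2 * Real.pi))⁻¹ * Real.exp (-x ^ 2 / 2) := by
    funext x; exact gaussianPDFReal_std x
  rw [h]
  have h1 : HasDerivAt (fun x : ℝ => -x ^ 2 / 2) (-x) x := by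
    have := ((hasDerivAt_pow 2 x).neg).div_const 2
    refine this.congr_deriv ?_
    simp; ring
  refine (h1.exp.const_mul _).congr_deriv ?_
  ring

theorem gaussianPDFReal_std_pos (x : ℝ) : 0 < gaussianPDFReal 0 1 x :=
  gaussianPDFReal_pos 0 1 x one_ne_zero

theorem integral_gaussianPDFReal_std : ∫ x, gaussianPDFReal 0 1 x = 1 :=
  integral_gaussianPDFReal_eq_one 0 one_ne_zero

theorem tendsto_gaussianPDFReal_std_cocompact :
    Tendsto (gaussianPDFReal 0 1) (cocompact ℝ) (𝓝 0) := by
  have h : gaussianPDFReal 0 1 = fun x => (√(2 * Real.pi))⁻¹ * Real.exp (-x ^ 2 / 2) := by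
    funext x; exact gaussianPDFReal_std x
  rw [h, ← mul_zero (√(2 * Real.pi))⁻¹]
  refine Tendsto.const_mul _ (Real.tendsto_exp_atBot.comp ?_)
  have h2 : Tendsto (fun x : ℝ => ‖x‖ ^ 2 / 2) (cocompact ℝ) atTop :=
    ((tendsto_pow_atTop two_ne_zero).comp (tendsto_norm_cocompact_atTop)).atTop_div_const two_pos
  refine (tendsto_neg_atTop_atBot.comp h2).congr fun x => ?_
  simp [neg_div]

theorem real_gaussianReal_Iic (s : ℝ) :
    gaussianReal 0 1 (Iic s) = ENNReal.ofReal (lowerInt (gaussianPDFReal 0 1) s) := by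
  rw [gaussianReal_apply_eq_integral 0 one_ne_zero]; rfl

/-- A measurable function with values in `(0, 1)` factors measurably through the Gaussian
distribution function. -/
theorem exists_measurable_gaussian_quantile {α : Type*} [MeasurableSpace α] {f : α → ℝ}
    (hf : Measurable f) (h01 : ∀ a, f a ∈ Ioo (0 : ℝ) 1) :
    ∃ S : α → ℝ, Measurable S ∧ ∀ a, lowerInt (gaussianPDFReal 0 1) (S a) = f a := by
  have hc := continuous_gaussianPDFReal 0 1
  choose S hS using fun a => exists_lowerInt_eq hc integral_gaussianPDFReal_std (h01 a)
  refine ⟨S, measurable_of_Iic fun s => ?_, hS⟩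
  have : S ⁻¹' Iic s = {a | f a ≤ lowerInt (gaussianPDFReal 0 1) s} := by
    ext a
    simp only [mem_preimage, mem_Iic, mem_ofPred_eq, ← hS a]
    exact (strictMono_lowerInt hc (integrable_gaussianPDFReal 0 1)
      gaussianPDFReal_std_pos).le_iff_le.symm
  rw [this]
  exact measurableSet_le hf measurable_const

end Gaussian

/-! ### Monotone rearrangement to the Gaussian and Talagrand's inequality on the line. -/

section Transport

variable {p S : ℝ → ℝ}

/-- A law on the line is determined by its values on half-lines. The preimage of `Iic s` is the
half-line `Iic x` with the same distribution value, because both distribution functions are strictly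
increasing. -/
theorem map_withDensity_quantile (hc : Continuous p) (hp : ∀ x, 0 < p x) (h1 : ∫ x, p x = 1)
    (hS : ∀ x, lowerInt (gaussianPDFReal 0 1) (S x) = lowerInt p x) (hSm : Measurable S) :
    (volume.withDensity fun x => ENNReal.ofReal (p x)).map S = gaussianReal 0 1 := by
  have hi := integrable_of_integral_eq_one' h1
  have hprob : IsProbabilityMeasure (volume.withDensity fun x => ENNReal.ofReal (p x)) := by
    refine ⟨?_⟩
    rw [withDensity_apply _ MeasurableSet.univ, setLIntegral_univ,
      ← ofReal_integral_eq_lintegral_ofReal hi (ae_of_all _ fun x => (hp x).le), h1]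
    simp
  have := Measure.isProbabilityMeasure_map (μ := volume.withDensity fun x => ENNReal.ofReal (p x))
    hSm.aemeasurable
  have hG := strictMono_lowerInt (continuous_gaussianPDFReal 0 1) (integrable_gaussianPDFReal 0 1)
    gaussianPDFReal_std_pos
  refine Measure.ext_of_Iic _ _ fun s => ?_
  obtain ⟨x, hx⟩ := exists_lowerInt_eq hc h1 (lowerInt_mem_Ioo (continuous_gaussianPDFReal 0 1)
    integral_gaussianPDFReal_std gaussianPDFReal_std_pos s)
  have hpre : S ⁻¹' Iic s = Iic x := by
    ext y
    rw [mem_preimage, mem_Iic, mem_Iic, ← hG.le_iff_le, hS, ← hx,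
      (strictMono_lowerInt hc hi hp).le_iff_le]
  rw [Measure.map_apply hSm measurableSet_Iic, hpre, withDensity_apply _ measurableSet_Iic,
    real_gaussianReal_Iic, ← hx, lowerInt,
    ofReal_integral_eq_lintegral_ofReal hi.integrableOn (ae_of_all _ fun x => (hp x).le)]

theorem strictMono_quantile (hc : Continuous p) (hp : ∀ x, 0 < p x) (h1 : ∫ x, p x = 1)
    (hS : ∀ x, lowerInt (gaussianPDFReal 0 1) (S x) = lowerInt p x) : StrictMono S := by
  have hi := integrable_of_integral_eq_one' h1
  intro x y hxy
  rw [← (strictMono_lowerInt (continuous_gaussianPDFReal 0 1) (integrable_gaussianPDFReal 0 1)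
    gaussianPDFReal_std_pos).lt_iff_lt, hS, hS]
  exact strictMono_lowerInt hc hi hp hxy

theorem surjective_quantile (hc : Continuous p) (h1 : ∫ x, p x = 1)
    (hS : ∀ x, lowerInt (gaussianPDFReal 0 1) (S x) = lowerInt p x) :
    Function.Surjective S := by
  intro s
  obtain ⟨x, hx⟩ := exists_lowerInt_eq hc h1 (lowerInt_mem_Ioo (continuous_gaussianPDFReal 0 1)
    integral_gaussianPDFReal_std gaussianPDFReal_std_pos s)
  refine ⟨x, (strictMono_lowerInt (continuous_gaussianPDFReal 0 1) (integrable_gaussianPDFReal 0 1)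
    gaussianPDFReal_std_pos).injective ?_⟩
  rw [hS, hx]

/-- The slope of `S` is the slope of `lowerInt p` divided by the slope of the Gaussian distribution
function between the values of `S`. The latter converges because `S`, a monotone surjection, is
continuous, and injective. -/
theorem hasDerivAt_quantile (hc : Continuous p) (hp : ∀ x, 0 < p x) (h1 : ∫ x, p x = 1)
    (hS : ∀ x, lowerInt (gaussianPDFReal 0 1) (S x) = lowerInt p x) (x : ℝ) :
    HasDerivAt S (p x / gaussianPDFReal 0 1 (S x)) x := by
  have hi := integrable_of_integral_eq_one' h1
  have hm := strictMono_quantile hc hp h1 hS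
  have hcont : Continuous S := hm.monotone.continuous_of_surjective (surjective_quantile hc h1 hS)
  have hG : StrictMono (lowerInt (gaussianPDFReal 0 1)) :=
    strictMono_lowerInt (continuous_gaussianPDFReal 0 1) (integrable_gaussianPDFReal 0 1)
      gaussianPDFReal_std_pos
  have hne : Tendsto S (𝓝[≠] x) (𝓝[≠] (S x)) :=
    hcont.continuousAt.continuousWithinAt.tendsto_nhdsWithin fun y hy => hm.injective.ne hy
  have h2 : Tendsto (fun y => slope (lowerInt (gaussianPDFReal 0 1)) (S x) (S y)) (𝓝[≠] x)
      (𝓝 (gaussianPDFReal 0 1 (S x))) :=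
    (hasDerivAt_lowerInt (continuous_gaussianPDFReal 0 1) (integrable_gaussianPDFReal 0 1)
      (S x)).tendsto_slope.comp hne
  rw [hasDerivAt_iff_tendsto_slope]
  refine ((hasDerivAt_lowerInt hc hi x).tendsto_slope.div h2
    (gaussianPDFReal_std_pos _).ne').congr' ?_
  filter_upwards [self_mem_nhdsWithin] with y hy
  have h3 : S y - S x ≠ 0 := sub_ne_zero.2 (hm.injective.ne hy)
  have h4 : y - x ≠ 0 := sub_ne_zero.2 hy
  have h5 : lowerInt p y - lowerInt p x ≠ 0 :=
    sub_ne_zero.2 ((strictMono_lowerInt hc hi hp).injective.ne hy)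
  simp only [Pi.div_apply, slope_def_field, hS]
  field_simp

/-- Integration by parts for the composition of the Gaussian density with the monotone
rearrangement: the boundary term vanishes. -/
theorem tendsto_mul_gaussianPDF_quantile (hc : Continuous p) (hp : ∀ x, 0 < p x)
    (h1 : ∫ x, p x = 1) (hS : ∀ x, lowerInt (gaussianPDFReal 0 1) (S x) = lowerInt p x)
    (hSp : Integrable fun x => S x * p x) (hxSp : Integrable fun x => x * S x * p x) :
    Tendsto (fun x => x * gaussianPDFReal 0 1 (S x)) atTop (𝓝 0) ∧
    Tendsto (fun x => x * gaussianPDFReal 0 1 (S x)) atBot (𝓝 0) := by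
  have hm := strictMono_quantile hc hp h1 hS
  have hsurj := surjective_quantile hc h1 hS
  have hder : ∀ x, HasDerivAt (fun x => gaussianPDFReal 0 1 (S x)) (-(S x * p x)) x := by
    intro x
    refine ((hasDerivAt_gaussianPDFReal_std (S x)).comp x
      (hasDerivAt_quantile hc hp h1 hS x)).congr_deriv ?_
    have := (gaussianPDFReal_std_pos (S x)).ne'
    field_simp
  have hSt : Tendsto S atTop atTop :=
    hm.monotone.tendsto_atTop_atTop fun b => (hsurj b).imp fun a h => h.ge
  have hSb : Tendsto S atBot atBot :=
    hm.monotone.tendsto_atBot_atBot fun b => (hsurj b).imp fun a h => h.le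
  have hgt : Tendsto (fun x => gaussianPDFReal 0 1 (S x)) atTop (𝓝 0) :=
    (tendsto_gaussianPDFReal_std_cocompact.mono_left atTop_le_cocompact).comp hSt
  have hgb : Tendsto (fun x => gaussianPDFReal 0 1 (S x)) atBot (𝓝 0) :=
    (tendsto_gaussianPDFReal_std_cocompact.mono_left atBot_le_cocompact).comp hSb
  have hn := hxSp.norm
  constructor
  · have htail : Tendsto (fun R => ∫ x in Ioi R, ‖x * S x * p x‖) atTop (𝓝 0) := by
      have h := (aecover_Iic (μ := volume) (tendsto_id (α := ℝ)
        (x := atTop))).integral_tendsto_of_countably_generated hn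
      have := h.const_sub (∫ x, ‖x * S x * p x‖)
      rw [sub_self] at this
      refine this.congr fun R => ?_
      have := integral_add_compl (measurableSet_Iic (a := R)) hn
      rw [compl_Iic] at this
      simp only [id]
      linarith
    refine squeeze_zero_norm' ?_ htail
    filter_upwards [eventually_ge_atTop 0] with R hR
    -- The value `φ(S R)` is itself the tail integral of `S p`. On the tail `R ≤ x`, so multiplying
    -- by `R` costs at most the tail of the integrable function `x S p`.
    have h2 : ∫ x in Ioi R, -(S x * p x) = 0 - gaussianPDFReal 0 1 (S R) :=
      integral_Ioi_of_hasDerivAt_of_tendsto' (fun x _ => hder x) hSp.neg.integrableOn hgt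
    have h3 : R * gaussianPDFReal 0 1 (S R) = ∫ x in Ioi R, R * (S x * p x) := by
      rw [integral_const_mul]
      rw [integral_neg] at h2
      rw [show ∫ x in Ioi R, S x * p x = gaussianPDFReal 0 1 (S R) by linarith]
    rw [h3]
    refine (norm_integral_le_integral_norm _).trans
      (setIntegral_mono_on (hSp.const_mul R).norm.integrableOn hn.integrableOn
        measurableSet_Ioi fun x hx => ?_)
    rw [mul_assoc, norm_mul, norm_mul x]
    gcongr
    rw [Real.norm_of_nonneg hR]
    exact (le_of_lt hx).trans (le_abs_self x)
  · have htail : Tendsto (fun R => ∫ x in Iic R, ‖x * S x * p x‖) atBot (𝓝 0) := by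
      have h := (aecover_Ioi (μ := volume) (tendsto_id (α := ℝ)
        (x := atBot))).integral_tendsto_of_countably_generated hn
      have := h.const_sub (∫ x, ‖x * S x * p x‖)
      rw [sub_self] at this
      refine this.congr fun R => ?_
      have := integral_add_compl (measurableSet_Iic (a := R)) hn
      rw [compl_Iic] at this
      simp only [id]
      linarith
    refine squeeze_zero_norm' ?_ htail
    filter_upwards [eventually_le_atBot 0] with R hR
    have h2 : ∫ x in Iic R, -(S x * p x) = gaussianPDFReal 0 1 (S R) - 0 :=
      integral_Iic_of_hasDerivAt_of_tendsto' (fun x _ => hder x) hSp.neg.integrableOn hgb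
    have h3 : R * gaussianPDFReal 0 1 (S R) = ∫ x in Iic R, R * -(S x * p x) := by
      rw [integral_const_mul, h2, sub_zero]
    rw [h3]
    refine (norm_integral_le_integral_norm _).trans
      (setIntegral_mono_on (hSp.neg.const_mul R).norm.integrableOn hn.integrableOn
        measurableSet_Iic fun x hx => ?_)
    rw [mul_assoc, norm_mul, norm_mul x, norm_neg]
    gcongr
    have hx' : x ≤ R := hx
    rw [Real.norm_of_nonpos hR, Real.norm_of_nonpos (hx'.trans hR)]
    linarith

theorem mul_log_div_gaussian (hp : ∀ x, 0 < p x) (x : ℝ) :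
    p x * Real.log (p x / gaussianPDFReal 0 1 x) =
      p x * Real.log (p x) + Real.log (√(2 * Real.pi)) * p x + x ^ 2 * p x / 2 := by
  rw [Real.log_div (hp x).ne' (gaussianPDFReal_std_pos x).ne', gaussianPDFReal_std,
    Real.log_mul (by positivity) (Real.exp_ne_zero _), Real.log_exp, Real.log_inv]
  ring

theorem integrable_mul_log_div_gaussian (hp : ∀ x, 0 < p x) (hi : Integrable p)
    (hx2 : Integrable fun x => x ^ 2 * p x) (hent : Integrable fun x => p x * Real.log (p x)) :
    Integrable fun x => p x * Real.log (p x / gaussianPDFReal 0 1 x) := by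
  simp only [mul_log_div_gaussian hp]
  exact (hent.add (hi.const_mul _)).add (hx2.div_const 2)

/-- **Talagrand's transport inequality on the line**: the monotone rearrangement `S` of the density
`p` to the standard Gaussian has quadratic cost at most twice the relative entropy. -/
theorem integral_sq_sub_quantile_le (hc : Continuous p) (hp : ∀ x, 0 < p x)
    (h1 : ∫ x, p x = 1) (hS : ∀ x, lowerInt (gaussianPDFReal 0 1) (S x) = lowerInt p x)
    (hSm : Measurable S) (hx2 : Integrable fun x => x ^ 2 * p x)
    (hent : Integrable fun x => p x * Real.log (p x)) :
    (Integrable fun x => (x - S x) ^ 2 * p x) ∧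
    ∫ x, (x - S x) ^ 2 * p x ≤ 2 * ∫ x, p x * Real.log (p x / gaussianPDFReal 0 1 x) := by
  have hi := integrable_of_integral_eq_one' h1
  have hmap := map_withDensity_quantile hc hp h1 hS hSm
  have hpm : Measurable p := hc.measurable
  have htr : ∀ f : ℝ → ℝ, Integrable (fun x => f x * p x) ↔
      Integrable f (volume.withDensity fun x => ENNReal.ofReal (p x)) := by
    intro f
    rw [integrable_withDensity_iff hpm.ennreal_ofReal (ae_of_all _ fun _ => ENNReal.ofReal_lt_top)]
    simp only [ENNReal.toReal_ofReal (hp _).le]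
  have hint : ∀ f : ℝ → ℝ, ∫ x, f x ∂(volume.withDensity fun x => ENNReal.ofReal (p x)) =
      ∫ x, f x * p x := by
    intro f
    rw [integral_withDensity_eq_integral_toReal_smul hpm.ennreal_ofReal
      (ae_of_all _ fun _ => ENNReal.ofReal_lt_top)]
    simp only [ENNReal.toReal_ofReal (hp _).le, smul_eq_mul, mul_comm]
  have hid2 : Integrable (fun y : ℝ => y ^ 2) (gaussianReal 0 1) :=
    (memLp_id_gaussianReal 2).integrable_sq
  have hS2 : Integrable fun x => S x ^ 2 * p x := by
    rw [htr]
    rw [← hmap] at hid2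
    exact hid2.comp_measurable hSm
  have hS2i : ∫ x, S x ^ 2 * p x = 1 := by
    rw [← hint, ← integral_map (f := fun y : ℝ => y ^ 2) hSm.aemeasurable (by fun_prop), hmap]
    have := variance_fun_id_gaussianReal (μ := 0) (v := 1)
    rw [variance_eq_integral (by fun_prop)] at this
    simpa using this
  have hxSp : Integrable fun x => x * S x * p x := by
    refine (hx2.add hS2).mono' (by fun_prop) (ae_of_all _ fun x => ?_)
    simp only [Pi.add_apply, norm_mul, Real.norm_eq_abs, abs_of_pos (hp x), ← add_mul]
    refine mul_le_mul_of_nonneg_right ?_ (hp x).le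
    rw [← sq_abs x, ← sq_abs (S x)]
    nlinarith [sq_nonneg (|x| - |S x|), sq_nonneg (|x|), sq_nonneg (|S x|)]
  have hSp : Integrable fun x => S x * p x := by
    refine (hi.add hS2).mono' (by fun_prop) (ae_of_all _ fun x => ?_)
    simp only [Pi.add_apply, norm_mul, Real.norm_eq_abs, abs_of_pos (hp x), ← one_add_mul]
    refine mul_le_mul_of_nonneg_right ?_ (hp x).le
    rw [← sq_abs (S x)]
    nlinarith [sq_nonneg (|S x| - 1)]
  have hlog := mul_log_div_gaussian hp
  have hE := integrable_mul_log_div_gaussian hp hi hx2 hent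
  -- Since `S' = p / φ(S)`, this is `log (1 / S') ≤ 1 / S' - 1` multiplied by `p`; it replaces the
  -- logarithm of the Jacobian by a linear term.
  have hpt : ∀ x, p x * Real.log (p x / gaussianPDFReal 0 1 x) ≥
      (x ^ 2 * p x - S x ^ 2 * p x) / 2 + p x - gaussianPDFReal 0 1 (S x) := by
    intro x
    have hg := gaussianPDFReal_std_pos (S x)
    have h2 : Real.log (gaussianPDFReal 0 1 (S x) / p x) ≤ gaussianPDFReal 0 1 (S x) / p x - 1 :=
      Real.log_le_sub_one_of_pos (div_pos hg (hp x))
    rw [Real.log_div hg.ne' (hp x).ne', gaussianPDFReal_std (S x),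
      Real.log_mul (by positivity) (Real.exp_ne_zero _), Real.log_exp, Real.log_inv,
      ← gaussianPDFReal_std] at h2
    rw [hlog]
    have h3 := mul_le_mul_of_nonneg_left h2 (hp x).le
    rw [mul_sub (p x) (gaussianPDFReal 0 1 (S x) / p x), mul_div_cancel₀ _ (hp x).ne'] at h3
    nlinarith [h3]
  have hsq : ∀ x, (x - S x) ^ 2 * p x = x ^ 2 * p x + S x ^ 2 * p x - 2 * (x * S x * p x) := by
    intro x; ring
  refine ⟨by simp only [hsq]; exact (hx2.add hS2).sub (hxSp.const_mul 2), ?_⟩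
  obtain ⟨hbt, hbb⟩ := tendsto_mul_gaussianPDF_quantile hc hp h1 hS hSp hxSp
  have hSc : Continuous S := (strictMono_quantile hc hp h1 hS).monotone.continuous_of_surjective
    (surjective_quantile hc h1 hS)
  have hgc : Continuous fun x => gaussianPDFReal 0 1 (S x) :=
    (continuous_gaussianPDFReal 0 1).comp hSc
  -- The derivative of `φ(S)` is `-S p`, so integrating `φ(S)` by parts produces the cross term of
  -- the quadratic cost. Bounded intervals are used because integrability of `φ(S)` on the line is
  -- not established.
  have hparts : ∀ R : ℝ, ∫ x in (-R)..R, gaussianPDFReal 0 1 (S x) =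
      R * gaussianPDFReal 0 1 (S R) - (-R) * gaussianPDFReal 0 1 (S (-R))
        + ∫ x in (-R)..R, x * S x * p x := by
    intro R
    have hd : ∀ x ∈ uIcc (-R) R, HasDerivAt (fun x => x * gaussianPDFReal 0 1 (S x))
        (gaussianPDFReal 0 1 (S x) - x * S x * p x) x := by
      intro x _
      refine ((hasDerivAt_id x).mul ((hasDerivAt_gaussianPDFReal_std (S x)).comp x
        (hasDerivAt_quantile hc hp h1 hS x))).congr_deriv ?_
      have := (gaussianPDFReal_std_pos (S x)).ne'
      simp only [id, Function.comp]
      field_simp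
      ring
    rw [← intervalIntegral.integral_eq_sub_of_hasDerivAt hd
      ((hgc.intervalIntegrable _ _).sub hxSp.intervalIntegrable),
      intervalIntegral.integral_sub (hgc.intervalIntegrable _ _) hxSp.intervalIntegrable]
    ring
  have hlim : ∀ {f : ℝ → ℝ}, Integrable f →
      Tendsto (fun R => ∫ x in (-R)..R, f x) atTop (𝓝 (∫ x, f x)) := fun hf =>
    intervalIntegral_tendsto_integral hf tendsto_neg_atTop_atBot tendsto_id
  -- As `∫ S² p = 1`, the left side equals half of `∫ (x - S)² p`.
  have hmain : (∫ x, x ^ 2 * p x - S x ^ 2 * p x) / 2 + 1 - ∫ x, x * S x * p x ≤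
      ∫ x, p x * Real.log (p x / gaussianPDFReal 0 1 x) := by
    have hD : Integrable fun x => x ^ 2 * p x - S x ^ 2 * p x := hx2.sub hS2
    have hA : Integrable fun x => (x ^ 2 * p x - S x ^ 2 * p x) / 2 + p x :=
      (hD.div_const 2).add hi
    have hL : Tendsto (fun R => (∫ x in (-R)..R, ((x ^ 2 * p x - S x ^ 2 * p x) / 2 + p x))
        - (R * gaussianPDFReal 0 1 (S R) - (-R) * gaussianPDFReal 0 1 (S (-R))
        + ∫ x in (-R)..R, x * S x * p x)) atTop
        (𝓝 ((∫ x, ((x ^ 2 * p x - S x ^ 2 * p x) / 2 + p x)) - (0 - 0 + ∫ x, x * S x * p x))) :=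
      (hlim hA).sub ((hbt.sub (hbb.comp tendsto_neg_atTop_atBot)).add (hlim hxSp))
    rw [integral_add (hD.div_const 2) hi, h1, integral_div] at hL
    have hle := le_of_tendsto_of_tendsto hL (hlim hE) ?_
    · linarith
    filter_upwards [eventually_ge_atTop 0] with R hR
    rw [← hparts, ← intervalIntegral.integral_sub hA.intervalIntegrable
      (hgc.intervalIntegrable _ _)]
    refine intervalIntegral.integral_mono_on (by linarith)
      (hA.intervalIntegrable.sub (hgc.intervalIntegrable _ _)) hE.intervalIntegrable fun x _ => hpt x
  simp only [hsq]
  have hA : Integrable fun x => x ^ 2 * p x + S x ^ 2 * p x := hx2.add hS2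
  rw [integral_sub hA (hxSp.const_mul 2), integral_add hx2 hS2, integral_const_mul,
    hS2i]
  rw [integral_sub hx2 hS2, hS2i] at hmain
  linarith

end Transport

/-- The root controls small `u` and the square large `u`. Both powers turn a Gaussian bound on a
density into a Gaussian bound again, which makes the entropy integrable. -/
theorem abs_mul_log_le {u : ℝ} (hu : 0 < u) : |u * Real.log u| ≤ 2 * √u + u ^ 2 := by
  rcases le_total u 1 with h | h
  · have hs : 0 < √u := Real.sqrt_pos.2 hu
    have h1 := Real.abs_log_mul_self_lt (√u) hs (Real.sqrt_le_one.2 h)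
    have h2 : u * Real.log u = 2 * √u * (Real.log √u * √u) := by
      rw [Real.log_sqrt hu.le]
      nth_rewrite 1 [← Real.mul_self_sqrt hu.le]
      ring
    rw [h2, abs_mul, abs_of_pos (by positivity)]
    nlinarith [sq_nonneg u]
  · rw [abs_of_nonneg (mul_nonneg hu.le (Real.log_nonneg h))]
    have := Real.log_le_sub_one_of_pos hu
    nlinarith [Real.sqrt_nonneg u]

/-- Half of the exponential rate absorbs the factor `N`; the root and the square of `p` decay at
rates `c / 2` and `2 c`. With `N` the squared norm, this serves both the one-dimensional
conditionals and the densities in `n` variables. -/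
theorem integrable_mul_and_mul_log_of_le {α : Type*} [MeasurableSpace α] {μ : Measure α}
    {p N : α → ℝ} (hpm : Measurable p) (hNm : Measurable N) (hp : ∀ x, 0 < p x)
    (hN : ∀ x, 0 ≤ N x) (hexp : ∀ c : ℝ, 0 < c → Integrable (fun x => Real.exp (-c * N x)) μ)
    {C c : ℝ} (hc : 0 < c) (hb : ∀ x, p x ≤ C * Real.exp (-c * N x)) :
    Integrable (fun x => N x * p x) μ ∧ Integrable (fun x => p x * Real.log (p x)) μ := by
  constructor
  · refine ((hexp (c / 2) (by positivity)).const_mul (2 / c * C)).mono'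
      (hNm.mul hpm).aestronglyMeasurable (ae_of_all _ fun x => ?_)
    rw [Real.norm_of_nonneg (mul_nonneg (hN x) (hp x).le)]
    have h1 : c / 2 * N x ≤ Real.exp (c / 2 * N x) :=
      (by linarith : c / 2 * N x ≤ c / 2 * N x + 1).trans (Real.add_one_le_exp _)
    have h2 : N x ≤ 2 / c * Real.exp (c / 2 * N x) := by
      calc N x = 2 / c * (c / 2 * N x) := by field_simp
        _ ≤ _ := by gcongr
    calc N x * p x ≤ 2 / c * Real.exp (c / 2 * N x) * (C * Real.exp (-c * N x)) :=
          mul_le_mul h2 (hb x) (hp x).le (by positivity)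
      _ = 2 / c * C * (Real.exp (c / 2 * N x) * Real.exp (-c * N x)) := by ring
      _ = _ := by rw [← Real.exp_add]; ring_nf
  · refine (((hexp (c / 2) (by positivity)).const_mul (2 * √C)).add
      ((hexp (2 * c) (by positivity)).const_mul (C ^ 2))).mono'
      (hpm.mul hpm.log).aestronglyMeasurable (ae_of_all _ fun x => ?_)
    refine (abs_mul_log_le (hp x)).trans (add_le_add ?_ ?_)
    · change 2 * √(p x) ≤ 2 * √C * Real.exp (-(c / 2) * N x)
      rw [mul_assoc]
      refine mul_le_mul_of_nonneg_left ?_ two_pos.le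
      calc √(p x) ≤ √(C * Real.exp (-c * N x)) := Real.sqrt_le_sqrt (hb x)
        _ = √C * √(Real.exp (-(c / 2) * N x) ^ 2) := by
          rw [Real.sqrt_mul' _ (Real.exp_nonneg _), ← Real.exp_nat_mul]
          congr 3; push_cast; ring
        _ = _ := by rw [Real.sqrt_sq (Real.exp_nonneg _)]
    · calc p x ^ 2 ≤ (C * Real.exp (-c * N x)) ^ 2 := pow_le_pow_left₀ (hp x).le (hb x) 2
        _ = _ := by
          rw [mul_pow, ← Real.exp_nat_mul]
          congr 2; push_cast; ring

/-! ### Splitting off the first coordinate. -/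

section Cons

variable {n : ℕ}

theorem measurable_cons {α : Type*} [MeasurableSpace α] {f : α → ℝ} {g : α → Fin n → ℝ}
    (hf : Measurable f) (hg : Measurable g) :
    Measurable fun a => (Fin.cons (f a) (g a) : Fin (n + 1) → ℝ) := by
  refine measurable_pi_lambda _ fun i => ?_
  refine Fin.cases ?_ (fun j => ?_) i
  · simpa using hf
  · simp only [Fin.cons_succ]; fun_prop

theorem cons_eq_piFinSuccAbove_symm :
    (fun w : ℝ × (Fin n → ℝ) => (Fin.cons w.1 w.2 : Fin (n + 1) → ℝ)) =
      (MeasurableEquiv.piFinSuccAbove (fun _ : Fin (n + 1) => ℝ) 0).symm := by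
  funext w
  simp [MeasurableEquiv.piFinSuccAbove]
  rfl

theorem measurePreserving_cons (μ : Measure ℝ) [SigmaFinite μ] :
    MeasurePreserving (fun w : ℝ × (Fin n → ℝ) => (Fin.cons w.1 w.2 : Fin (n + 1) → ℝ))
      (μ.prod (Measure.pi fun _ => μ)) (Measure.pi fun _ => μ) := by
  rw [cons_eq_piFinSuccAbove_symm]
  exact (measurePreserving_piFinSuccAbove (fun _ : Fin (n + 1) => μ) 0).symm

theorem lintegral_pi_cons (μ : Measure ℝ) [SigmaFinite μ] {g : (Fin (n + 1) → ℝ) → ℝ≥0∞}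
    (hg : Measurable g) :
    ∫⁻ z, g z ∂(Measure.pi fun _ => μ) =
      ∫⁻ x, ∫⁻ y, g (Fin.cons y x) ∂μ ∂(Measure.pi fun _ => μ) := by
  have h := measurePreserving_cons (n := n) μ
  rw [← h.lintegral_comp hg, lintegral_prod_symm _ (by exact (hg.comp h.measurable).aemeasurable)]

theorem lintegral_cons {g : (Fin (n + 1) → ℝ) → ℝ≥0∞} (hg : Measurable g) :
    ∫⁻ z, g z = ∫⁻ x : Fin n → ℝ, ∫⁻ y : ℝ, g (Fin.cons y x) :=
  lintegral_pi_cons volume hg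

theorem measurableEmbedding_cons :
    MeasurableEmbedding fun w : ℝ × (Fin n → ℝ) => (Fin.cons w.1 w.2 : Fin (n + 1) → ℝ) := by
  rw [cons_eq_piFinSuccAbove_symm]
  exact (MeasurableEquiv.piFinSuccAbove (fun _ : Fin (n + 1) => ℝ) 0).symm.measurableEmbedding

theorem integrable_comp_cons {f : (Fin (n + 1) → ℝ) → ℝ} (hf : Integrable f) :
    Integrable (fun w : ℝ × (Fin n → ℝ) => f (Fin.cons w.1 w.2)) (volume.prod volume) :=
  (measurePreserving_cons (n := n) volume).integrable_comp_of_integrable hf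

theorem integral_cons {f : (Fin (n + 1) → ℝ) → ℝ} (hf : Integrable f) :
    ∫ z, f z = ∫ x : Fin n → ℝ, ∫ y : ℝ, f (Fin.cons y x) := by
  have h := (measurePreserving_cons (n := n) volume).integral_comp measurableEmbedding_cons f
  have h2 := integral_prod_symm _ (integrable_comp_cons hf)
  exact h.symm.trans h2

end Cons

/-! ### Tame densities, their marginals and their conditionals. -/

/-- Continuous positive probability densities with a Gaussian upper bound. -/
structure TameDensity {n : ℕ} (p : (Fin n → ℝ) → ℝ) : Prop where
  continuous : Continuous p
  pos : ∀ x, 0 < p x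
  bound : ∃ C c : ℝ, 0 < c ∧ ∀ x, p x ≤ C * Real.exp (-c * ∑ i, x i ^ 2)
  integral_eq_one : ∫ x, p x = 1

/-- The standard Gaussian density on `Fin n → ℝ`. -/
noncomputable def stdPDF {n : ℕ} (x : Fin n → ℝ) : ℝ := ∏ i, gaussianPDFReal 0 1 (x i)

theorem stdPDF_pos {n : ℕ} (x : Fin n → ℝ) : 0 < stdPDF x :=
  Finset.prod_pos fun i _ => gaussianPDFReal_std_pos (x i)

theorem continuous_stdPDF {n : ℕ} : Continuous (stdPDF (n := n)) :=
  continuous_finsetProd _ fun i _ =>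
    (continuous_gaussianPDFReal 0 1).comp (continuous_apply i)

theorem stdPDF_cons {n : ℕ} (y : ℝ) (x : Fin n → ℝ) :
    stdPDF (Fin.cons y x : Fin (n + 1) → ℝ) = gaussianPDFReal 0 1 y * stdPDF x := by
  simp [stdPDF, Fin.prod_univ_succ]

theorem log_stdPDF {n : ℕ} (x : Fin n → ℝ) :
    Real.log (stdPDF x) = -(n * Real.log (√(2 * Real.pi)) + (∑ i, x i ^ 2) / 2) := by
  rw [stdPDF, Real.log_prod (fun i _ => (gaussianPDFReal_std_pos (x i)).ne')]
  have h : ∀ i, Real.log (gaussianPDFReal 0 1 (x i)) =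
      -(Real.log (√(2 * Real.pi)) + x i ^ 2 / 2) := by
    intro i
    rw [gaussianPDFReal_std, Real.log_mul (by positivity) (Real.exp_ne_zero _), Real.log_exp,
      Real.log_inv]
    ring
  simp only [h, Finset.sum_neg_distrib, Finset.sum_add_distrib, Finset.sum_const,
    Finset.card_univ, Fintype.card_fin, nsmul_eq_mul, Finset.sum_div]

theorem integrable_exp_neg_sum_sq {n : ℕ} {c : ℝ} (hc : 0 < c) :
    Integrable fun x : Fin n → ℝ => Real.exp (-c * ∑ i, x i ^ 2) := by
  simp only [Finset.mul_sum, Real.exp_sum]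
  exact Integrable.fintype_prod (f := fun (_ : Fin n) (y : ℝ) => Real.exp (-c * y ^ 2))
    fun _ => integrable_exp_neg_mul_sq hc

namespace TameDensity

variable {n : ℕ} {p : (Fin n → ℝ) → ℝ}

theorem integrable (h : TameDensity p) : Integrable p :=
  integrable_of_integral_eq_one' h.integral_eq_one

theorem integrable_mul_log_div (h : TameDensity p) :
    Integrable fun x => p x * Real.log (p x / stdPDF x) := by
  obtain ⟨C, c, hc, hb⟩ := h.bound
  obtain ⟨h1, h2⟩ := integrable_mul_and_mul_log_of_le (μ := volume) h.continuous.measurable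
    (N := fun x : Fin n → ℝ => ∑ i, x i ^ 2) (by fun_prop) h.pos
    (fun x => Finset.sum_nonneg fun i _ => sq_nonneg _)
    (fun c hc => integrable_exp_neg_sum_sq hc) hc hb
  have : ∀ x, p x * Real.log (p x / stdPDF x) = p x * Real.log (p x) +
      n * Real.log (√(2 * Real.pi)) * p x + (∑ i, x i ^ 2) * p x / 2 := by
    intro x
    rw [Real.log_div (h.pos x).ne' (stdPDF_pos x).ne', log_stdPDF]
    ring
  simp only [this]
  exact (h2.add (h.integrable.const_mul _)).add (h1.div_const 2)

end TameDensity

section Marginal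

variable {n : ℕ} {p : (Fin (n + 1) → ℝ) → ℝ}

/-- The density of all coordinates but the first. -/
noncomputable def tailMarginal (p : (Fin (n + 1) → ℝ) → ℝ) (x : Fin n → ℝ) : ℝ :=
  ∫ y, p (Fin.cons y x)

theorem continuous_cons_left (x : Fin n → ℝ) :
    Continuous fun y : ℝ => (Fin.cons y x : Fin (n + 1) → ℝ) := by
  refine continuous_pi fun i => ?_
  refine Fin.cases ?_ (fun j => ?_) i
  · simpa using continuous_id'
  · simpa using continuous_const

theorem continuous_cons_right (y : ℝ) :
    Continuous fun x : Fin n → ℝ => (Fin.cons y x : Fin (n + 1) → ℝ) := by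
  refine continuous_pi fun i => ?_
  refine Fin.cases ?_ (fun j => ?_) i
  · simpa using continuous_const
  · simpa using continuous_apply j

namespace TameDensity

theorem exists_bound_cons (h : TameDensity p) : ∃ C c : ℝ, 0 < c ∧ ∀ y x,
    p (Fin.cons y x) ≤ C * Real.exp (-c * ∑ i, x i ^ 2) * Real.exp (-c * y ^ 2) := by
  obtain ⟨C, c, hc, hb⟩ := h.bound
  refine ⟨C, c, hc, fun y x => (hb _).trans (le_of_eq ?_)⟩
  rw [mul_assoc, ← Real.exp_add, Fin.sum_univ_succ]
  simp only [Fin.cons_zero, Fin.cons_succ]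
  ring_nf

theorem continuous_section (h : TameDensity p) (x : Fin n → ℝ) :
    Continuous fun y => p (Fin.cons y x) := h.continuous.comp (continuous_cons_left x)

theorem integrable_section (h : TameDensity p) (x : Fin n → ℝ) :
    Integrable fun y => p (Fin.cons y x) := by
  obtain ⟨C, c, hc, hb⟩ := h.exists_bound_cons
  refine ((integrable_exp_neg_mul_sq hc).const_mul (C * Real.exp (-c * ∑ i, x i ^ 2))).mono'
    (h.continuous_section x).aestronglyMeasurable (ae_of_all _ fun y => ?_)
  rw [Real.norm_of_nonneg (h.pos _).le]
  exact hb y x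

theorem tailMarginal_pos (h : TameDensity p) (x : Fin n → ℝ) : 0 < tailMarginal p x := by
  rw [tailMarginal, integral_pos_iff_support_of_nonneg (fun y => (h.pos _).le)
    (h.integrable_section x)]
  have : Function.support (fun y => p (Fin.cons y x)) = univ :=
    Function.support_eq_univ fun y => (h.pos _).ne'
  simp [this]

/-- The Gaussian bound factorises over the coordinates. One factor dominates the integral over the
first coordinate, which gives continuity; the other is the bound on the marginal. This closure
property is what allows the induction on the dimension. -/
theorem tailMarginal (h : TameDensity p) : TameDensity (tailMarginal p) where
  continuous := by
    obtain ⟨C, c, hc, hb⟩ := h.exists_bound_cons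
    have hC : 0 ≤ C := by
      have := (h.pos _).le.trans (hb 0 0)
      simpa using this
    refine continuous_of_dominated (bound := fun y => C * Real.exp (-c * y ^ 2))
      (fun x => (h.continuous_section x).aestronglyMeasurable)
      (fun x => ae_of_all _ fun y => ?_) ((integrable_exp_neg_mul_sq hc).const_mul C)
      (ae_of_all _ fun y => h.continuous.comp (continuous_cons_right y))
    rw [Real.norm_of_nonneg (h.pos _).le]
    refine (hb y x).trans (mul_le_mul_of_nonneg_right ?_ (Real.exp_nonneg _))
    refine mul_le_of_le_one_right hC (Real.exp_le_one_iff.2 ?_)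
    have : 0 ≤ ∑ i, x i ^ 2 := Finset.sum_nonneg fun i _ => sq_nonneg _
    nlinarith
  pos := h.tailMarginal_pos
  bound := by
    obtain ⟨C, c, hc, hb⟩ := h.exists_bound_cons
    refine ⟨C * √(Real.pi / c), c, hc, fun x => ?_⟩
    refine (integral_mono (h.integrable_section x)
      ((integrable_exp_neg_mul_sq hc).const_mul _) fun y => hb y x).trans (le_of_eq ?_)
    rw [integral_const_mul, integral_gaussian]
    ring
  integral_eq_one := by
    rw [← h.integral_eq_one, integral_cons h.integrable]
    rfl

/-- The facts about a conditional density that the one-dimensional inequality needs. -/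
theorem conditional (h : TameDensity p) (x : Fin n → ℝ) :
    (Continuous fun y => p (Fin.cons y x) / _root_.tailMarginal p x) ∧
    (∀ y, 0 < p (Fin.cons y x) / _root_.tailMarginal p x) ∧
    ∫ y, p (Fin.cons y x) / _root_.tailMarginal p x = 1 ∧
    (Integrable fun y => y ^ 2 * (p (Fin.cons y x) / _root_.tailMarginal p x)) ∧
    (Integrable fun y => p (Fin.cons y x) / _root_.tailMarginal p x *
      Real.log (p (Fin.cons y x) / _root_.tailMarginal p x)) := by
  have hq := h.tailMarginal_pos x
  have hc1 : Continuous fun y => p (Fin.cons y x) / _root_.tailMarginal p x :=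
    (h.continuous_section x).div_const _
  have hp1 : ∀ y, 0 < p (Fin.cons y x) / _root_.tailMarginal p x := fun y => div_pos (h.pos _) hq
  obtain ⟨C, c, hc, hb⟩ := h.exists_bound_cons
  obtain ⟨h1, h2⟩ := integrable_mul_and_mul_log_of_le (μ := volume) hc1.measurable
    (N := fun y : ℝ => y ^ 2) (by fun_prop) hp1 (fun y => sq_nonneg y)
    (fun c hc => integrable_exp_neg_mul_sq hc)
    (C := C * Real.exp (-c * ∑ i, x i ^ 2) / _root_.tailMarginal p x) hc
    (fun y => by
      rw [div_mul_eq_mul_div]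
      exact div_le_div_of_nonneg_right (hb y x) hq.le)
  refine ⟨hc1, hp1, ?_, h1, h2⟩
  rw [integral_div]
  exact div_self hq.ne'

end TameDensity

end Marginal

/-! ### The Knothe map and Talagrand's inequality in all dimensions. -/

/-- The conditional distribution function is jointly measurable by Fubini, and composing with the
Gaussian quantile preserves this. Measurability in `a` is needed to assemble the fibrewise
rearrangements into one map. -/
theorem exists_measurable_conditional_quantile {A : Type*} [MeasurableSpace A] {r : A → ℝ → ℝ}
    (hm : Measurable (Function.uncurry r)) (hc : ∀ a, Continuous (r a)) (hp : ∀ a y, 0 < r a y)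
    (h1 : ∀ a, ∫ y, r a y = 1) :
    ∃ S : A × ℝ → ℝ, Measurable S ∧
      ∀ a y, lowerInt (gaussianPDFReal 0 1) (S (a, y)) = lowerInt (r a) y := by
  have hF : Measurable fun w : A × ℝ => lowerInt (r w.1) w.2 := by
    have h2 : Measurable fun v : (A × ℝ) × ℝ => (Iic v.1.2).indicator (r v.1.1) v.2 := by
      have : (fun v : (A × ℝ) × ℝ => (Iic v.1.2).indicator (r v.1.1) v.2) =
          {v : (A × ℝ) × ℝ | v.2 ≤ v.1.2}.indicator
            fun v => Function.uncurry r (v.1.1, v.2) := by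
        funext v
        simp only [indicator, mem_Iic, mem_ofPred_eq, Function.uncurry]
      rw [this]
      exact (hm.comp (by fun_prop)).indicator (measurableSet_le (by fun_prop) (by fun_prop))
    have h3 := StronglyMeasurable.integral_prod_right (ν := (volume : Measure ℝ))
      (f := fun (w : A × ℝ) (s : ℝ) => (Iic w.2).indicator (r w.1) s) h2.stronglyMeasurable
    simp only [integral_indicator measurableSet_Iic] at h3
    exact h3.measurable
  obtain ⟨S, hSm, hS⟩ := exists_measurable_gaussian_quantile hF
    fun w => lowerInt_mem_Ioo (hc w.1) (h1 w.1) (hp w.1) w.2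
  exact ⟨S, hSm, fun a y => hS (a, y)⟩

theorem lintegral_withDensity_ofReal {α : Type*} [MeasurableSpace α] {μ : Measure α} {f : α → ℝ}
    (hf : Measurable f) {g : α → ℝ≥0∞} (hg : Measurable g) :
    ∫⁻ x, g x ∂(μ.withDensity fun x => ENNReal.ofReal (f x)) =
      ∫⁻ x, ENNReal.ofReal (f x) * g x ∂μ :=
  lintegral_withDensity_eq_lintegral_mul _ hf.ennreal_ofReal hg

theorem lintegral_ofReal_mul {α : Type*} [MeasurableSpace α] {μ : Measure α} {f : α → ℝ} {c : ℝ}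
    (hc : 0 ≤ c) (hf : Integrable f μ) (h0 : ∀ x, 0 ≤ f x) :
    ∫⁻ x, ENNReal.ofReal (c * f x) ∂μ = ENNReal.ofReal (c * ∫ x, f x ∂μ) := by
  rw [← integral_const_mul, ofReal_integral_eq_lintegral_ofReal (hf.const_mul c)
    (ae_of_all _ fun x => mul_nonneg hc (h0 x))]

/-- **Talagrand's transport inequality** for tame densities, by the Knothe rearrangement: a family
of tame densities that is jointly measurable is transported to the standard Gaussian by a jointly
measurable family of maps, at a quadratic cost of at most twice the relative entropy. -/
theorem exists_knothe (n : ℕ) : ∀ {Θ : Type*} [MeasurableSpace Θ] (p : Θ → (Fin n → ℝ) → ℝ),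
    Measurable (Function.uncurry p) → (∀ θ, TameDensity (p θ)) →
    ∃ S : Θ → (Fin n → ℝ) → (Fin n → ℝ), Measurable (Function.uncurry S) ∧ ∀ θ,
      (volume.withDensity fun x => ENNReal.ofReal (p θ x)).map (S θ) =
        Measure.pi (fun _ => gaussianReal 0 1) ∧
      0 ≤ ∫ x, p θ x * Real.log (p θ x / stdPDF x) ∧
      ∫⁻ x, ENNReal.ofReal ((∑ i, (x i - S θ x i) ^ 2) * p θ x) ≤
        ENNReal.ofReal (2 * ∫ x, p θ x * Real.log (p θ x / stdPDF x)) := by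
  induction n with
  | zero =>
    intro Θ _ p _ hp
    have h1 : ∀ θ x, p θ x = 1 := by
      intro θ x
      have h := (hp θ).integral_eq_one
      rw [volume_pi, Measure.pi_of_empty _ x, integral_dirac] at h
      exact h
    refine ⟨fun _ x => x, measurable_snd, fun θ => ⟨?_, ?_, ?_⟩⟩
    · simp only [h1, ENNReal.ofReal_one]
      rw [volume_pi, Measure.pi_of_empty _ 0, Measure.pi_of_empty _ 0]
      simp
    · simp [h1, stdPDF]
    · simp
  | succ n ih =>
    intro Θ _ p hm hp
    set q : Θ → (Fin n → ℝ) → ℝ := fun θ => tailMarginal (p θ) with hq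
    have hqt : ∀ θ, TameDensity (q θ) := fun θ => (hp θ).tailMarginal
    have hmc : Measurable fun w : (Θ × (Fin n → ℝ)) × ℝ => p w.1.1 (Fin.cons w.2 w.1.2) :=
      hm.comp (g := Function.uncurry p) (f := fun w : (Θ × (Fin n → ℝ)) × ℝ =>
        (w.1.1, (Fin.cons w.2 w.1.2 : Fin (n + 1) → ℝ)))
        ((by fun_prop : Measurable fun w : (Θ × (Fin n → ℝ)) × ℝ => w.1.1).prodMk
          (measurable_cons (by fun_prop) (by fun_prop)))
    have hqm : Measurable (Function.uncurry q) :=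
      (hmc.stronglyMeasurable.integral_prod_right (ν := (volume : Measure ℝ))).measurable
    obtain ⟨S1, hS1m, hS1⟩ := ih q hqm hqt
    obtain ⟨r, hr⟩ : ∃ r : Θ × (Fin n → ℝ) → ℝ → ℝ, r = fun a y => p a.1 (Fin.cons y a.2) / q a.1 a.2 :=
      ⟨_, rfl⟩
    have hrm : Measurable (Function.uncurry r) := by
      rw [hr]
      exact hmc.div (hqm.comp measurable_fst)
    have hcond : ∀ a, Continuous (r a) ∧ (∀ y, 0 < r a y) ∧ ∫ y, r a y = 1 ∧
        (Integrable fun y => y ^ 2 * r a y) ∧ (Integrable fun y => r a y * Real.log (r a y)) :=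
      fun a => by
        rw [hr]
        exact (hp a.1).conditional a.2
    have hpq : ∀ θ x y, p θ (Fin.cons y x) = q θ x * r (θ, x) y := fun θ x y => by
      rw [hr]
      exact (mul_div_cancel₀ _ ((hqt θ).pos x).ne').symm
    obtain ⟨S0, hS0m, hS0⟩ := exists_measurable_conditional_quantile hrm
      (fun a => (hcond a).1) (fun a => (hcond a).2.1) (fun a => (hcond a).2.2.1)
    have hS0s : ∀ a, Measurable fun y => S0 (a, y) := fun a => hS0m.comp measurable_prodMk_left
    have hS1s : ∀ θ, Measurable (S1 θ) := fun θ => hS1m.comp measurable_prodMk_left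
    have hps : ∀ θ, Measurable (p θ) := fun θ => (hp θ).continuous.measurable
    have hone := fun a : Θ × (Fin n → ℝ) => integral_sq_sub_quantile_le (hcond a).1 (hcond a).2.1
      (hcond a).2.2.1 (hS0 a) (hS0s a) (hcond a).2.2.2.1 (hcond a).2.2.2.2
    -- The triangular map: the tail is moved by the inductive map for its marginal, the first
    -- coordinate by the quantile map of its conditional law given the original tail.
    refine ⟨fun θ z => Fin.cons (S0 ((θ, Fin.tail z), z 0)) (S1 θ (Fin.tail z)), ?_, fun θ => ?_⟩
    · have ht : Measurable fun w : Θ × (Fin (n + 1) → ℝ) => Fin.tail w.2 :=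
        measurable_pi_lambda _ fun i => (measurable_pi_apply i.succ).comp measurable_snd
      refine measurable_cons (hS0m.comp ((measurable_fst.prodMk ht).prodMk
        ((measurable_pi_apply 0).comp measurable_snd)))
        (hS1m.comp (measurable_fst.prodMk ht))
    have hSm : Measurable fun z : Fin (n + 1) → ℝ =>
        (Fin.cons (S0 ((θ, Fin.tail z), z 0)) (S1 θ (Fin.tail z)) : Fin (n + 1) → ℝ) := by
      have ht : Measurable fun w : Fin (n + 1) → ℝ => Fin.tail w :=
        measurable_pi_lambda _ fun i => measurable_pi_apply i.succ
      exact measurable_cons (hS0m.comp ((measurable_const.prodMk ht).prodMk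
        (measurable_pi_apply 0))) ((hS1s θ).comp ht)
    have hmap0 := fun a : Θ × (Fin n → ℝ) => map_withDensity_quantile (hcond a).1 (hcond a).2.1
      (hcond a).2.2.1 (hS0 a) (hS0s a)
    have hE := (hp θ).integrable_mul_log_div
    have hE1 := (hqt θ).integrable_mul_log_div
    -- the chain rule for the relative entropy
    have hchain : ∀ x, ∫ y, p θ (Fin.cons y x) *
        Real.log (p θ (Fin.cons y x) / stdPDF (Fin.cons y x : Fin (n + 1) → ℝ)) =
        q θ x * Real.log (q θ x / stdPDF x) +
          q θ x * ∫ y, r (θ, x) y * Real.log (r (θ, x) y / gaussianPDFReal 0 1 y) := by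
      intro x
      have hri := integrable_of_integral_eq_one' (hcond (θ, x)).2.2.1
      have hrE := integrable_mul_log_div_gaussian (hcond (θ, x)).2.1 hri (hcond (θ, x)).2.2.2.1
        (hcond (θ, x)).2.2.2.2
      have h1 := integral_add (hri.const_mul (q θ x * Real.log (q θ x / stdPDF x)))
        (hrE.const_mul (q θ x))
      rw [integral_const_mul, integral_const_mul, (hcond (θ, x)).2.2.1, mul_one] at h1
      rw [← h1]
      refine integral_congr_ae (ae_of_all _ fun y => ?_)
      have hq0 := (hqt θ).pos x
      have hr0 : 0 < r (θ, x) y := (hcond (θ, x)).2.1 y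
      change _ = q θ x * Real.log (q θ x / stdPDF x) * r (θ, x) y +
        q θ x * (r (θ, x) y * Real.log (r (θ, x) y / gaussianPDFReal 0 1 y))
      simp only []
      rw [stdPDF_cons, hpq, mul_comm (gaussianPDFReal 0 1 y), mul_div_mul_comm,
        Real.log_mul (div_pos hq0 (stdPDF_pos x)).ne'
          (div_pos hr0 (gaussianPDFReal_std_pos y)).ne']
      ring
    -- Integrability of the conditional entropy comes by subtraction in the chain rule, not from an
    -- estimate.
    have hEq : Integrable fun x =>
        q θ x * ∫ y, r (θ, x) y * Real.log (r (θ, x) y / gaussianPDFReal 0 1 y) := by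
      have h := (integrable_comp_cons hE).integral_prod_right
      simp only [hchain] at h
      refine (h.sub hE1).congr (ae_of_all _ fun x => ?_)
      simp
    -- The one-dimensional transport inequality itself gives the sign. Nonnegativity is carried
    -- through the induction because `ENNReal.ofReal` is additive only on nonnegative reals.
    have hnn : ∀ x, 0 ≤ ∫ y, r (θ, x) y * Real.log (r (θ, x) y / gaussianPDFReal 0 1 y) := by
      intro x
      have h := (integral_nonneg fun y => mul_nonneg (sq_nonneg _)
        ((hcond (θ, x)).2.1 y).le).trans (hone (θ, x)).2
      linarith
    have hsum : ∫ z, p θ z * Real.log (p θ z / stdPDF z) =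
        (∫ x, q θ x * Real.log (q θ x / stdPDF x)) +
        ∫ x, q θ x * ∫ y, r (θ, x) y * Real.log (r (θ, x) y / gaussianPDFReal 0 1 y) := by
      rw [integral_cons hE, ← integral_add hE1 hEq]
      simp only [hchain]
    have hnn2 : 0 ≤ ∫ x, q θ x *
        ∫ y, r (θ, x) y * Real.log (r (θ, x) y / gaussianPDFReal 0 1 y) :=
      integral_nonneg fun x => mul_nonneg ((hqt θ).pos x).le (hnn x)
    refine ⟨?_, ?_, ?_⟩
    · refine Measure.ext_of_lintegral _ fun g hg => ?_
      have hgc : ∀ x', Measurable fun y => g (Fin.cons y x') := fun x' =>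
        hg.comp (continuous_cons_left _).measurable
      have hgS : Measurable fun z : Fin (n + 1) → ℝ =>
        g (Fin.cons (S0 ((θ, Fin.tail z), z 0)) (S1 θ (Fin.tail z))) := hg.comp hSm
      have hgi : Measurable fun x : Fin n → ℝ => ∫⁻ y, g (Fin.cons y x) ∂(gaussianReal 0 1) :=
        Measurable.lintegral_prod_right' (ν := gaussianReal 0 1)
          (f := fun w : (Fin n → ℝ) × ℝ => g (Fin.cons w.2 w.1))
          (hg.comp (measurable_cons measurable_snd measurable_fst))
      rw [lintegral_map hg hSm, lintegral_withDensity_ofReal (hps θ) hgS,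
        lintegral_cons (by exact (hps θ).ennreal_ofReal.mul hgS), lintegral_pi_cons _ hg, ← (hS1 θ).1,
        lintegral_map hgi (hS1s θ), lintegral_withDensity_ofReal
        (hqt θ).continuous.measurable (by exact hgi.comp (hS1s θ))]
      refine lintegral_congr fun x => ?_
      simp only [Fin.tail_cons, Fin.cons_zero]
      rw [← hmap0 (θ, x), lintegral_map (hgc _) (hS0s _), lintegral_withDensity_ofReal
        (hcond (θ, x)).1.measurable (by exact (hgc _).comp (hS0s _)),
        ← lintegral_const_mul' _ _ ENNReal.ofReal_ne_top]
      refine lintegral_congr fun y => ?_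
      rw [hpq, ENNReal.ofReal_mul ((hqt θ).pos x).le, mul_assoc]
    · rw [hsum]
      exact add_nonneg (hS1 θ).2.1 hnn2
    · have hcm : Measurable fun z : Fin (n + 1) → ℝ => ENNReal.ofReal ((∑ i, (z i -
          (Fin.cons (S0 ((θ, Fin.tail z), z 0)) (S1 θ (Fin.tail z)) : Fin (n + 1) → ℝ) i) ^ 2) *
          p θ z) := by
        refine Measurable.ennreal_ofReal (Measurable.mul (Finset.measurable_fun_sum _ fun i _ => ?_)
          (hps θ))
        exact ((measurable_pi_apply i).sub ((measurable_pi_apply i).comp hSm)).pow_const 2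
      rw [lintegral_cons hcm, hsum, mul_add, ENNReal.ofReal_add
        (mul_nonneg two_pos.le (hS1 θ).2.1) (mul_nonneg two_pos.le hnn2),
        add_comm (ENNReal.ofReal _) (ENNReal.ofReal _),
        ← integral_const_mul, ofReal_integral_eq_lintegral_ofReal (hEq.const_mul 2)
          (ae_of_all _ fun x => mul_nonneg two_pos.le (mul_nonneg ((hqt θ).pos x).le (hnn x)))]
      refine le_trans (le_of_eq ?_) (add_le_add (lintegral_mono fun x =>
        (?_ : ENNReal.ofReal (q θ x * ∫ y, (y - S0 ((θ, x), y)) ^ 2 * r (θ, x) y) ≤ _))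
        (hS1 θ).2.2)
      -- The squared distance splits into the first coordinate and the tail, matching the two terms
      -- of the chain rule.
      · rw [← lintegral_add_right]
        · refine lintegral_congr fun x => ?_
          have hs : 0 ≤ ∑ i, (x i - S1 θ x i) ^ 2 := Finset.sum_nonneg fun i _ => sq_nonneg _
          rw [← lintegral_ofReal_mul ((hqt θ).pos x).le (hone (θ, x)).1
            (fun y => mul_nonneg (sq_nonneg _) ((hcond (θ, x)).2.1 y).le)]
          have hq1 : ENNReal.ofReal ((∑ i, (x i - S1 θ x i) ^ 2) * q θ x) =
              ∫⁻ y, ENNReal.ofReal ((∑ i, (x i - S1 θ x i) ^ 2) * p θ (Fin.cons y x)) := by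
            rw [lintegral_ofReal_mul hs ((hp θ).integrable_section x) fun y => ((hp θ).pos _).le]
            rfl
          rw [hq1, ← lintegral_add_right]
          · refine lintegral_congr fun y => ?_
            rw [← ENNReal.ofReal_add, Fin.sum_univ_succ]
            · simp only [Fin.cons_zero, Fin.cons_succ, Fin.tail_cons]
              rw [hpq]
              ring_nf
            · exact mul_nonneg ((hqt θ).pos x).le
                (mul_nonneg (sq_nonneg _) ((hcond (θ, x)).2.1 y).le)
            · exact mul_nonneg hs ((hp θ).pos _).le
          · exact (((hp θ).continuous_section x).measurable.const_mul _).ennreal_ofReal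
        · refine Measurable.ennreal_ofReal (Measurable.mul (Finset.measurable_fun_sum _
            fun i _ => ?_) (hqt θ).continuous.measurable)
          exact ((measurable_pi_apply i).sub ((measurable_pi_apply i).comp (hS1s θ))).pow_const 2
      · refine ENNReal.ofReal_le_ofReal ?_
        calc _ ≤ q θ x * (2 * ∫ y, r (θ, x) y * Real.log (r (θ, x) y / gaussianPDFReal 0 1 y)) :=
              mul_le_mul_of_nonneg_left (hone (θ, x)).2 ((hqt θ).pos x).le
          _ = _ := by ring

/-! ### Gaussian densities and Mehler's kernel. -/

/-- The density of the Gaussian vector with mean `a` and covariance `v • I`. -/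
noncomputable def gaussPDF {n : ℕ} (v : NNReal) (a x : Fin n → ℝ) : ℝ :=
  ∏ i, gaussianPDFReal (a i) v (x i)

section GaussPDF

variable {n : ℕ} {v : NNReal}

theorem gaussPDF_pos (hv : v ≠ 0) (a x : Fin n → ℝ) : 0 < gaussPDF v a x :=
  Finset.prod_pos fun _ _ => gaussianPDFReal_pos _ _ _ hv

theorem continuous_gaussPDF (v : NNReal) :
    Continuous fun w : (Fin n → ℝ) × (Fin n → ℝ) => gaussPDF v w.1 w.2 := by
  unfold gaussPDF gaussianPDFReal
  fun_prop

theorem gaussPDF_eq (v : NNReal) (a x : Fin n → ℝ) :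
    gaussPDF v a x =
      (√(2 * Real.pi * v))⁻¹ ^ n * Real.exp (-(∑ i, (x i - a i) ^ 2) / (2 * v)) := by
  simp only [gaussPDF, gaussianPDFReal, Finset.prod_mul_distrib, Finset.prod_const,
    Finset.card_univ, Fintype.card_fin, ← Real.exp_sum, ← Finset.sum_div,
    Finset.sum_neg_distrib]

theorem gaussPDF_le (v : NNReal) (a x : Fin n → ℝ) :
    gaussPDF v a x ≤ (√(2 * Real.pi * v))⁻¹ ^ n := by
  rw [gaussPDF_eq]
  refine mul_le_of_le_one_right (by positivity) (Real.exp_le_one_iff.2 ?_)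
  rw [neg_div]
  have : 0 ≤ (∑ i, (x i - a i) ^ 2) / (2 * v) :=
    div_nonneg (Finset.sum_nonneg fun i _ => sq_nonneg _) (by positivity)
  linarith

/-- From `(x - 2 a)² ≥ 0` one gets `(x - a)² ≥ x² / 2 - a²`. Giving up half of the decay makes the
bound uniform over bounded means, so it survives mixing. -/
theorem gaussPDF_le_exp (v : NNReal) (a x : Fin n → ℝ) :
    gaussPDF v a x ≤ (√(2 * Real.pi * v))⁻¹ ^ n * Real.exp ((∑ i, a i ^ 2) / (2 * v)) *
      Real.exp (-(1 / (4 * v)) * ∑ i, x i ^ 2) := by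
  rw [gaussPDF_eq, mul_assoc ((√(2 * Real.pi * v))⁻¹ ^ n), ← Real.exp_add]
  gcongr
  have h1 : -(∑ i, (x i - a i) ^ 2) ≤ (∑ i, a i ^ 2) - (∑ i, x i ^ 2) / 2 := by
    rw [Finset.sum_div, ← Finset.sum_sub_distrib, ← Finset.sum_neg_distrib]
    refine Finset.sum_le_sum fun i _ => ?_
    nlinarith [sq_nonneg (x i - 2 * a i)]
  refine (div_le_div_of_nonneg_right h1 (by positivity)).trans (le_of_eq ?_)
  rcases eq_or_ne (v : ℝ) 0 with h | h
  · simp [h]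
  · field_simp
    ring

theorem pi_gaussianReal_eq_withDensity (hv : v ≠ 0) (a : Fin n → ℝ) :
    Measure.pi (fun i => gaussianReal (a i) v) =
      volume.withDensity fun x => ENNReal.ofReal (gaussPDF v a x) := by
  refine Measure.pi_eq fun s hs => ?_
  have hms : MeasurableSet (univ.pi s) := MeasurableSet.univ_pi hs
  have hind : ∀ x, (univ.pi s).indicator (fun x => gaussPDF v a x) x =
      ∏ i, (s i).indicator (gaussianPDFReal (a i) v) (x i) := by
    intro x
    by_cases hx : x ∈ univ.pi s
    · rw [indicator_of_mem hx, gaussPDF]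
      exact Finset.prod_congr rfl fun i _ => (indicator_of_mem (hx i (mem_univ i)) _).symm
    · rw [indicator_of_notMem hx]
      simp only [Set.mem_pi, mem_univ, true_implies, not_forall] at hx
      obtain ⟨i, hi⟩ := hx
      exact (Finset.prod_eq_zero (Finset.mem_univ i) (indicator_of_notMem hi _)).symm
  have hintp : Integrable fun x : Fin n → ℝ =>
      ∏ i, (s i).indicator (gaussianPDFReal (a i) v) (x i) :=
    Integrable.fintype_prod (f := fun i => (s i).indicator (gaussianPDFReal (a i) v))
      fun i => (integrable_gaussianPDFReal _ _).indicator (hs i)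
  rw [withDensity_apply _ hms, ← lintegral_indicator hms]
  have h1 : ∀ x, (univ.pi s).indicator (fun x => ENNReal.ofReal (gaussPDF v a x)) x =
      ENNReal.ofReal (∏ i, (s i).indicator (gaussianPDFReal (a i) v) (x i)) := by
    intro x
    rw [← hind]
    by_cases hx : x ∈ univ.pi s <;> simp [hx]
  simp only [h1]
  have hnn : ∀ i y, 0 ≤ (s i).indicator (gaussianPDFReal (a i) v) y := fun i y =>
    indicator_nonneg (fun z _ => gaussianPDFReal_nonneg _ _ _) _
  rw [← ofReal_integral_eq_lintegral_ofReal hintp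
    (ae_of_all _ fun x => Finset.prod_nonneg fun i _ => hnn i _),
    integral_fintype_prod_volume_eq_prod, ENNReal.ofReal_prod_of_nonneg
    fun i _ => integral_nonneg (hnn i)]
  refine Finset.prod_congr rfl fun i _ => ?_
  rw [gaussianReal_apply_eq_integral _ hv, integral_indicator (hs i)]

theorem lintegral_gaussPDF (hv : v ≠ 0) (a : Fin n → ℝ) :
    ∫⁻ x, ENNReal.ofReal (gaussPDF v a x) = 1 := by
  have h := congrArg (fun m : Measure (Fin n → ℝ) => m univ) (pi_gaussianReal_eq_withDensity hv a)
  simpa using h.symm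

theorem map_pi_gaussianReal (v : NNReal) (a : Fin n → ℝ) :
    (Measure.pi fun _ => gaussianReal 0 1).map (fun g => a + √(v : ℝ) • g) =
      Measure.pi (fun i => gaussianReal (a i) v) := by
  have h := Measure.pi_map_pi (μ := fun _ : Fin n => gaussianReal 0 1)
    (f := fun i y => a i + √(v : ℝ) * y) (fun i => by fun_prop)
  have h2 : ∀ i, (gaussianReal 0 1).map (fun y => a i + √(v : ℝ) * y) = gaussianReal (a i) v := by
    intro i
    have h3 : (fun y => a i + √(v : ℝ) * y) = (fun y => a i + y) ∘ (fun y => √(v : ℝ) * y) := rfl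
    rw [h3, ← Measure.map_map (by fun_prop) (by fun_prop), gaussianReal_map_const_mul,
      gaussianReal_map_const_add]
    congr 1
    · simp
    · ext; simp
  simp only [h2] at h
  rw [← h]
  rfl

/-- Completing the square: the product of two Gaussian densities of variance `1 - ρ` against the
inverse of the standard one is a multiple of a Gaussian density (Mehler's kernel). -/
theorem gaussianPDFReal_mul_div {r : ℝ} (hr : 0 < r) (hr1 : r < 1) {v w : NNReal}
    (hv : (v : ℝ) = 1 - r) (hw : (w : ℝ) = (1 - r) / (1 + r)) (a b x : ℝ) :
    gaussianPDFReal a v x * gaussianPDFReal b v x / gaussianPDFReal 0 1 x =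
      (√(1 - r ^ 2))⁻¹ * Real.exp ((2 * (a * b) - r * (a ^ 2 + b ^ 2)) / (2 * (1 - r ^ 2))) *
        gaussianPDFReal ((a + b) / (1 + r)) w x := by
  have h1 : 0 < 1 - r := by linarith
  have h2 : 0 < 1 + r := by linarith
  have h3 : 1 - r ^ 2 = (1 - r) * (1 + r) := by ring
  rw [gaussianPDFReal_std]
  simp only [gaussianPDFReal, hv, hw]
  have hpre : (√(2 * Real.pi * (1 - r)))⁻¹ * (√(2 * Real.pi * (1 - r)))⁻¹ * √(2 * Real.pi) =
      (√(1 - r ^ 2))⁻¹ * (√(2 * Real.pi * ((1 - r) / (1 + r))))⁻¹ := by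
    rw [← mul_inv, ← mul_inv, Real.mul_self_sqrt (by positivity), ← Real.sqrt_mul (by
      rw [h3]; positivity), show (1 - r ^ 2) * (2 * Real.pi * ((1 - r) / (1 + r))) =
      (2 * Real.pi) * (1 - r) ^ 2 by field_simp; ring, Real.sqrt_mul (by positivity : 0 ≤ 2 * Real.pi),
      Real.sqrt_sq h1.le]
    have : √(2 * Real.pi) ≠ 0 := by positivity
    have h4 : 2 * Real.pi = √(2 * Real.pi) * √(2 * Real.pi) :=
      (Real.mul_self_sqrt (by positivity)).symm
    nth_rewrite 1 [h4]
    field_simp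
  have hexp : -(x - a) ^ 2 / (2 * (1 - r)) + -(x - b) ^ 2 / (2 * (1 - r)) - -x ^ 2 / 2 =
      (2 * (a * b) - r * (a ^ 2 + b ^ 2)) / (2 * (1 - r ^ 2)) +
        -(x - (a + b) / (1 + r)) ^ 2 / (2 * ((1 - r) / (1 + r))) := by
    rw [h3]
    field_simp
    ring
  rw [mul_mul_mul_comm, ← Real.exp_add, mul_mul_mul_comm (√(1 - r ^ 2))⁻¹, ← Real.exp_add, ← hexp,
    Real.exp_sub, ← hpre]
  have : √(2 * Real.pi) ≠ 0 := by positivity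
  field_simp

theorem gaussPDF_mul_div {r : ℝ} (hr : 0 < r) (hr1 : r < 1) {v w : NNReal}
    (hv : (v : ℝ) = 1 - r) (hw : (w : ℝ) = (1 - r) / (1 + r)) (a b x : Fin n → ℝ) :
    gaussPDF v a x * gaussPDF v b x / stdPDF x =
      (√(1 - r ^ 2))⁻¹ ^ n * Real.exp ((2 * (∑ i, a i * b i) -
        r * ((∑ i, a i ^ 2) + ∑ i, b i ^ 2)) / (2 * (1 - r ^ 2))) *
        gaussPDF w (fun i => (a i + b i) / (1 + r)) x := by
  rw [gaussPDF, gaussPDF, stdPDF, ← Finset.prod_mul_distrib, ← Finset.prod_div_distrib]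
  simp only [gaussianPDFReal_mul_div hr hr1 hv hw, Finset.prod_mul_distrib, Finset.prod_const,
    Finset.card_univ, Fintype.card_fin, ← Real.exp_sum, gaussPDF]
  congr 3
  rw [← Finset.sum_div, Finset.sum_sub_distrib, ← Finset.mul_sum, ← Finset.mul_sum,
    Finset.sum_add_distrib]

end GaussPDF

/-! ### Gaussian mixtures: relative density, entropy and the third-order cancellation. -/

/-- The density of `A + √v g`, for a random vector `A` and an independent standard Gaussian `g`. -/
noncomputable def mixPDF {n : ℕ} {S : Type*} [MeasurableSpace S] (Q : Measure S) (v : NNReal)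
    (A : S → Fin n → ℝ) (x : Fin n → ℝ) : ℝ := ∫ s, gaussPDF v (A s) x ∂Q

section MixPDF

variable {n : ℕ} {S : Type*} [MeasurableSpace S] {Q : Measure S} [IsProbabilityMeasure Q]
  {v : NNReal} {A : S → Fin n → ℝ}

theorem measurable_gaussPDF_comp {α : Type*} [MeasurableSpace α] (v : NNReal)
    {f g : α → Fin n → ℝ} (hf : Measurable f) (hg : Measurable g) :
    Measurable fun z => gaussPDF v (f z) (g z) := by
  have h := (continuous_gaussPDF (n := n) v).measurable.comp (hf.prodMk hg)
  simpa only [Function.comp_def] using h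

theorem continuous_gaussPDF_right (v : NNReal) (a : Fin n → ℝ) : Continuous (gaussPDF v a) := by
  unfold gaussPDF gaussianPDFReal
  fun_prop

theorem integrable_gaussPDF (hv : v ≠ 0) (hA : Measurable A) (x : Fin n → ℝ) :
    Integrable (fun s => gaussPDF v (A s) x) Q :=
  (integrable_const ((√(2 * Real.pi * v))⁻¹ ^ n)).mono'
    (measurable_gaussPDF_comp v hA measurable_const).aestronglyMeasurable
    (ae_of_all _ fun s => by
      rw [Real.norm_of_nonneg (gaussPDF_pos hv _ _).le]; exact gaussPDF_le v _ _)

theorem map_add_gaussian (hv : v ≠ 0) (hA : Measurable A) :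
    (Q.prod (Measure.pi fun _ => gaussianReal 0 1)).map
      (fun w : S × (Fin n → ℝ) => A w.1 + √(v : ℝ) • w.2) =
      volume.withDensity fun x => ENNReal.ofReal (mixPDF Q v A x) := by
  have hGm : Measurable fun w : S × (Fin n → ℝ) => gaussPDF v (A w.1) w.2 :=
    measurable_gaussPDF_comp v (hA.comp measurable_fst) measurable_snd
  have hm : Measurable fun w : S × (Fin n → ℝ) => A w.1 + √(v : ℝ) • w.2 :=
    (hA.comp measurable_fst).add (measurable_snd.const_smul (√(v : ℝ)))
  have hp : Measurable (mixPDF Q v A) :=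
    (StronglyMeasurable.integral_prod_left (f := fun s x => gaussPDF v (A s) x)
      hGm.stronglyMeasurable).measurable
  refine Measure.ext_of_lintegral _ fun g hg => ?_
  rw [lintegral_map hg hm, lintegral_prod _ (by exact (hg.comp hm).aemeasurable),
    lintegral_withDensity_ofReal hp hg]
  have h1 : ∀ s, ∫⁻ y, g (A s + √(v : ℝ) • y) ∂(Measure.pi fun _ => gaussianReal 0 1) =
      ∫⁻ x, ENNReal.ofReal (gaussPDF v (A s) x) * g x := by
    intro s
    rw [← lintegral_map (f := g) hg (by fun_prop : Measurable fun y => A s + √(v : ℝ) • y),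
      map_pi_gaussianReal, pi_gaussianReal_eq_withDensity hv, lintegral_withDensity_ofReal
      (continuous_gaussPDF_right v (A s)).measurable hg]
  simp only [h1]
  rw [lintegral_lintegral_swap]
  · refine lintegral_congr fun x => ?_
    rw [lintegral_mul_const _ (measurable_gaussPDF_comp v hA
      measurable_const).ennreal_ofReal, mixPDF,
      ofReal_integral_eq_lintegral_ofReal (integrable_gaussPDF hv hA x)
      (ae_of_all _ fun s => (gaussPDF_pos hv _ _).le)]
  · exact (hGm.ennreal_ofReal.mul (hg.comp measurable_snd)).aemeasurable

theorem tameDensity_mixPDF (hv : v ≠ 0) (hA : Measurable A) {B : ℝ}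
    (hB : ∀ᵐ s ∂Q, ∑ i, A s i ^ 2 ≤ B) : TameDensity (mixPDF Q v A) := by
  have hv0 : (0 : ℝ) < v := NNReal.coe_pos.2 (pos_iff_ne_zero.2 hv)
  have hcont : Continuous (mixPDF Q v A) :=
    continuous_of_dominated (bound := fun _ => (√(2 * Real.pi * v))⁻¹ ^ n)
      (fun x => (integrable_gaussPDF hv hA x).aestronglyMeasurable)
      (fun x => ae_of_all _ fun s => by
        rw [Real.norm_of_nonneg (gaussPDF_pos hv _ _).le]; exact gaussPDF_le v _ _)
      (integrable_const _) (ae_of_all _ fun s => continuous_gaussPDF_right v (A s))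
  have hpos : ∀ x, 0 < mixPDF Q v A x := by
    intro x
    rw [mixPDF, integral_pos_iff_support_of_nonneg (fun s => (gaussPDF_pos hv _ _).le)
      (integrable_gaussPDF hv hA x)]
    have : Function.support (fun s => gaussPDF v (A s) x) = univ :=
      Function.support_eq_univ fun s => (gaussPDF_pos hv _ _).ne'
    simp [this]
  refine ⟨hcont, hpos, ⟨(√(2 * Real.pi * v))⁻¹ ^ n * Real.exp (B / (2 * v)), 1 / (4 * v),
    by positivity, fun x => ?_⟩, ?_⟩
  · have h := integral_mono_ae (integrable_gaussPDF hv hA x)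
      (integrable_const ((√(2 * Real.pi * v))⁻¹ ^ n * Real.exp (B / (2 * v)) *
        Real.exp (-(1 / (4 * v)) * ∑ i, x i ^ 2))) (by
      filter_upwards [hB] with s hs
      refine (gaussPDF_le_exp v _ _).trans ?_
      gcongr)
    rw [integral_const, probReal_univ, one_smul] at h
    exact h
  · have hm : Measurable fun w : S × (Fin n → ℝ) => A w.1 + √(v : ℝ) • w.2 :=
      (hA.comp measurable_fst).add (measurable_snd.const_smul (√(v : ℝ)))
    have h := congrArg (fun m : Measure (Fin n → ℝ) => m univ) (map_add_gaussian (Q := Q) hv hA)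
    simp only [Measure.map_apply hm MeasurableSet.univ, preimage_univ, measure_univ,
      withDensity_apply _ MeasurableSet.univ, setLIntegral_univ] at h
    rw [integral_eq_lintegral_of_nonneg_ae (ae_of_all _ fun x => (hpos x).le)
      hcont.aestronglyMeasurable, ← h, ENNReal.toReal_one]

/-- The second moment of the relative density of the mixture, as an integral over two independent
copies of the mixing variable. -/
theorem lintegral_mixPDF_sq_div {r : ℝ} (hr : 0 < r) (hr1 : r < 1) (hvr : (v : ℝ) = 1 - r)
    (hA : Measurable A) :
    ∫⁻ x, ENNReal.ofReal (mixPDF Q v A x ^ 2 / stdPDF x) =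
      ∫⁻ w, ENNReal.ofReal ((√(1 - r ^ 2))⁻¹ ^ n * Real.exp ((2 * (∑ i, A w.1 i * A w.2 i) -
        r * ((∑ i, A w.1 i ^ 2) + ∑ i, A w.2 i ^ 2)) / (2 * (1 - r ^ 2)))) ∂(Q.prod Q) := by
  have hv : v ≠ 0 := by
    rintro rfl
    simp at hvr
    linarith
  have h1 : 0 < 1 - r := by linarith
  obtain ⟨w, hw⟩ : ∃ w : NNReal, (w : ℝ) = (1 - r) / (1 + r) := ⟨⟨_, by positivity⟩, rfl⟩
  have hw0 : w ≠ 0 := by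
    rw [← NNReal.coe_ne_zero, hw]; positivity
  have hint : ∀ x, Integrable (fun z : S × S => gaussPDF v (A z.1) x * gaussPDF v (A z.2) x)
      (Q.prod Q) := fun x => (integrable_gaussPDF hv hA x).mul_prod (integrable_gaussPDF hv hA x)
  -- The square of an integral is a double integral over two copies. After the swap below, the
  -- `x`-dependence is a single Gaussian density of mass one.
  have hsq : ∀ x, ENNReal.ofReal (mixPDF Q v A x ^ 2 / stdPDF x) =
      ∫⁻ z : S × S, ENNReal.ofReal (gaussPDF v (A z.1) x * gaussPDF v (A z.2) x / stdPDF x)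
        ∂(Q.prod Q) := by
    intro x
    rw [← ofReal_integral_eq_lintegral_ofReal ((hint x).div_const _) (ae_of_all _ fun z =>
      div_nonneg (mul_nonneg (gaussPDF_pos hv _ _).le (gaussPDF_pos hv _ _).le)
        (stdPDF_pos x).le), integral_div,
      integral_prod_mul (fun s => gaussPDF v (A s) x) fun s => gaussPDF v (A s) x, mixPDF, sq]
  simp only [hsq, gaussPDF_mul_div hr hr1 hvr hw]
  rw [lintegral_lintegral_swap]
  · refine lintegral_congr fun z => ?_
    have hnn : 0 ≤ (√(1 - r ^ 2))⁻¹ ^ n * Real.exp ((2 * (∑ i, A z.1 i * A z.2 i) -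
        r * ((∑ i, A z.1 i ^ 2) + ∑ i, A z.2 i ^ 2)) / (2 * (1 - r ^ 2))) := by positivity
    simp only [ENNReal.ofReal_mul hnn]
    rw [lintegral_const_mul' _ _ ENNReal.ofReal_ne_top, lintegral_gaussPDF hw0, mul_one]
  · refine Measurable.aemeasurable ?_
    have hA1 : Measurable fun z : (Fin n → ℝ) × S × S => A z.2.1 := hA.comp (by fun_prop)
    have hA2 : Measurable fun z : (Fin n → ℝ) × S × S => A z.2.2 := hA.comp (by fun_prop)
    have hi1 : ∀ i, Measurable fun z : (Fin n → ℝ) × S × S => A z.2.1 i :=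
      fun i => (measurable_pi_apply i).comp hA1
    have hi2 : ∀ i, Measurable fun z : (Fin n → ℝ) × S × S => A z.2.2 i :=
      fun i => (measurable_pi_apply i).comp hA2
    have hG : Measurable fun z : (Fin n → ℝ) × S × S =>
        gaussPDF w (fun i => (A z.2.1 i + A z.2.2 i) / (1 + r)) z.1 :=
      measurable_gaussPDF_comp w
        (measurable_pi_lambda _ fun i => ((hi1 i).add (hi2 i)).div_const _) measurable_fst
    have hE : Measurable fun z : (Fin n → ℝ) × S × S =>
        Real.exp ((2 * (∑ i, A z.2.1 i * A z.2.2 i) -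
          r * ((∑ i, A z.2.1 i ^ 2) + ∑ i, A z.2.2 i ^ 2)) / (2 * (1 - r ^ 2))) :=
      ((((Finset.measurable_fun_sum _ fun i _ => (hi1 i).mul (hi2 i)).const_mul 2).sub
        (((Finset.measurable_fun_sum _ fun i _ => (hi1 i).pow_const 2).add
          (Finset.measurable_fun_sum _ fun i _ => (hi2 i).pow_const 2)).const_mul r)).div_const
          _).exp
    exact ((hE.const_mul _).mul hG).ennreal_ofReal

/-- Jensen's inequality for the logarithm in tangent form: `log u ≤ ε - 1 + exp (-ε) u`, with `u`
the relative density, integrated against `p`. -/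
theorem integral_mul_log_le_of_lintegral_sq_div_le {p : (Fin n → ℝ) → ℝ} (hp : TameDensity p)
    {ε : ℝ} (h : ∫⁻ x, ENNReal.ofReal (p x ^ 2 / stdPDF x) ≤ ENNReal.ofReal (Real.exp ε)) :
    ∫ x, p x * Real.log (p x / stdPDF x) ≤ ε := by
  have hnn : ∀ x, 0 ≤ p x ^ 2 / stdPDF x := fun x => div_nonneg (sq_nonneg _) (stdPDF_pos x).le
  have hm : AEStronglyMeasurable (fun x => p x ^ 2 / stdPDF x) :=
    ((hp.continuous.pow 2).div continuous_stdPDF fun x => (stdPDF_pos x).ne').aestronglyMeasurable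
  have hi : Integrable fun x => p x ^ 2 / stdPDF x := by
    refine ⟨hm, ?_⟩
    rw [hasFiniteIntegral_iff_ofReal (ae_of_all _ hnn)]
    exact h.trans_lt ENNReal.ofReal_lt_top
  have hle : ∫ x, p x ^ 2 / stdPDF x ≤ Real.exp ε := by
    rw [← ofReal_integral_eq_lintegral_ofReal hi (ae_of_all _ hnn)] at h
    exact (ENNReal.ofReal_le_ofReal_iff (Real.exp_nonneg _)).1 h
  have hpt : ∀ x, p x * Real.log (p x / stdPDF x) ≤
      (ε - 1) * p x + Real.exp (-ε) * (p x ^ 2 / stdPDF x) := by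
    intro x
    have hu : 0 < p x / stdPDF x := div_pos (hp.pos x) (stdPDF_pos x)
    have h1 := Real.log_le_sub_one_of_pos (mul_pos (Real.exp_pos (-ε)) hu)
    rw [Real.log_mul (Real.exp_ne_zero _) hu.ne', Real.log_exp] at h1
    have h2 := mul_le_mul_of_nonneg_left h1 (hp.pos x).le
    calc p x * Real.log (p x / stdPDF x)
        = p x * (-ε + Real.log (p x / stdPDF x)) + ε * p x := by ring
      _ ≤ p x * (Real.exp (-ε) * (p x / stdPDF x) - 1) + ε * p x := by gcongr
      _ = _ := by ring
  have hint : Integrable fun x => (ε - 1) * p x + Real.exp (-ε) * (p x ^ 2 / stdPDF x) :=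
    (hp.integrable.const_mul _).add (hi.const_mul _)
  refine (integral_mono hp.integrable_mul_log_div hint hpt).trans ?_
  rw [integral_add (hp.integrable.const_mul _) (hi.const_mul _), integral_const_mul,
    integral_const_mul, hp.integral_eq_one]
  have := mul_le_mul_of_nonneg_left hle (Real.exp_nonneg (-ε))
  rw [← Real.exp_add, neg_add_cancel, Real.exp_zero] at this
  linarith

/-- The constant `2 / 9` is `4 / (3! * 3)`, from the Taylor remainder `Real.exp_bound` at order
three. -/
theorem exp_le_of_abs_le_one {w : ℝ} (hw : |w| ≤ 1) :
    Real.exp w ≤ 1 + w + w ^ 2 / 2 + 2 / 9 * |w| ^ 3 := by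
  have h := (abs_le.1 (Real.exp_bound hw (n := 3) (by norm_num))).2
  norm_num [Finset.sum_range_succ, Nat.factorial] at h
  linarith

/-- Elementary inequality behind the expansion of Mehler's kernel to second order. -/
theorem mehler_pointwise_bound {r b u N : ℝ} (hr : 0 < r) (hb : 1 ≤ b) (hrb : r * b ^ 2 ≤ 1 / 2)
    (hu : |u| ≤ b ^ 2) (hN0 : 0 ≤ N) (hN : N ≤ 2 * b ^ 2) :
    Real.exp ((2 * (r * u) - r * (r * N)) / (2 * (1 - r ^ 2))) ≤
      1 + (r * u - r ^ 2 * N / 2) / (1 - r ^ 2) +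
        (r ^ 2 * u ^ 2 + 3 * r ^ 3 * b ^ 4) / (2 * (1 - r ^ 2) ^ 2) + 16 / 9 * r ^ 3 * b ^ 6 := by
  have hb2 : 1 ≤ b ^ 2 := one_le_pow₀ hb
  have hr2 : r ≤ 1 / 2 := by nlinarith
  have hd : 3 / 4 ≤ 1 - r ^ 2 := by nlinarith
  have hd0 : 0 < 1 - r ^ 2 := by linarith
  set m := r * u - r ^ 2 * N / 2 with hm
  have hw : (2 * (r * u) - r * (r * N)) / (2 * (1 - r ^ 2)) = m / (1 - r ^ 2) := by
    rw [hm]; field_simp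
  have habs : |m| ≤ r * b ^ 2 * (1 + r) := by
    refine (abs_sub _ _).trans ?_
    rw [abs_mul, abs_of_pos hr, abs_of_nonneg (by positivity : 0 ≤ r ^ 2 * N / 2)]
    nlinarith [mul_le_mul_of_nonneg_left hu hr.le, mul_le_mul_of_nonneg_left hN (sq_nonneg r)]
  -- The right side is at most `1`, so the Taylor bound applies; its cube yields the constant `16 /
  -- 9 = 8 * 2 / 9`.
  have hwabs : |m / (1 - r ^ 2)| ≤ 2 * (r * b ^ 2) := by
    rw [abs_div, abs_of_pos hd0, div_le_iff₀ hd0]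
    refine habs.trans ?_
    have : 0 ≤ r * b ^ 2 := by positivity
    nlinarith
  have h1 := exp_le_of_abs_le_one (hwabs.trans (by linarith))
  rw [hw]
  refine h1.trans ?_
  have h3 : |m / (1 - r ^ 2)| ^ 3 ≤ 8 * (r ^ 3 * b ^ 6) := by
    calc |m / (1 - r ^ 2)| ^ 3 ≤ (2 * (r * b ^ 2)) ^ 3 := pow_le_pow_left₀ (abs_nonneg _) hwabs 3
      _ = _ := by ring
  have h2 : (m / (1 - r ^ 2)) ^ 2 / 2 ≤
      (r ^ 2 * u ^ 2 + 3 * r ^ 3 * b ^ 4) / (2 * (1 - r ^ 2) ^ 2) := by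
    rw [div_pow, div_div, mul_comm ((1 - r ^ 2) ^ 2)]
    refine div_le_div_of_nonneg_right ?_ (by positivity)
    have e1 : m ^ 2 = r ^ 2 * u ^ 2 - r ^ 3 * (u * N) + r ^ 4 * N ^ 2 / 4 := by rw [hm]; ring
    have e2 : -(u * N) ≤ b ^ 2 * (2 * b ^ 2) := by
      refine (neg_le_abs _).trans ?_
      rw [abs_mul, abs_of_nonneg hN0]
      exact mul_le_mul hu hN hN0 (by positivity)
    have e3 : N ^ 2 ≤ (2 * b ^ 2) ^ 2 := pow_le_pow_left₀ hN0 hN 2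
    have e4 : r ^ 4 ≤ r ^ 3 := by
      have : 0 < r ^ 3 := by positivity
      nlinarith
    have e5 : r ^ 4 * N ^ 2 / 4 ≤ r ^ 3 * b ^ 4 := by
      calc r ^ 4 * N ^ 2 / 4 ≤ r ^ 3 * (2 * b ^ 2) ^ 2 / 4 := by gcongr
        _ = _ := by ring
    have e6 := mul_le_mul_of_nonneg_left e2 (by positivity : 0 ≤ r ^ 3)
    rw [e1]
    nlinarith
  linarith

/-- The numerical estimate that balances the second-order terms of Mehler's kernel. -/
theorem mehler_normalisation_bound {n : ℕ} {r b : ℝ} (hr : 0 < r) (hb : 1 ≤ b)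
    (hrb : r * b ^ 2 ≤ 1 / 2) (hn : (n : ℝ) ≤ b ^ 2) :
    (√(1 - r ^ 2))⁻¹ ^ n * (1 - r ^ 2 * n / (1 - r ^ 2) +
        (r ^ 2 * n + 3 * r ^ 3 * b ^ 4) / (2 * (1 - r ^ 2) ^ 2) + 16 / 9 * r ^ 3 * b ^ 6) ≤
      Real.exp (5 * r ^ 3 * b ^ 6) := by
  have hb2 : 1 ≤ b ^ 2 := one_le_pow₀ hb
  have hr2 : r ≤ 1 / 2 := by nlinarith
  have hd : 3 / 4 ≤ 1 - r ^ 2 := by nlinarith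
  have hd0 : 0 < 1 - r ^ 2 := by linarith
  obtain ⟨η, hη⟩ : ∃ η, η = (1 - r ^ 2)⁻¹ := ⟨_, rfl⟩
  have hη0 : 0 < η := by rw [hη]; positivity
  have hη1 : η ≤ 4 / 3 := by
    rw [hη, inv_le_comm₀ hd0 (by norm_num)]; linarith
  have hη2 : η - 1 = r ^ 2 * η := by rw [hη]; field_simp; ring
  -- Here `√η ≤ exp ((η - 1) / 2)`, by `1 + x ≤ exp x` at `x = η - 1 = r ^ 2 η`.
  have hD : (√(1 - r ^ 2))⁻¹ ^ n ≤ Real.exp (n * (r ^ 2 * η) / 2) := by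
    have h1 : (√(1 - r ^ 2))⁻¹ = √η := by rw [hη, Real.sqrt_inv]
    have h2 : √η ≤ Real.exp (r ^ 2 * η / 2) := by
      rw [Real.sqrt_le_left (Real.exp_nonneg _), ← Real.exp_nat_mul, ← hη2]
      have := Real.add_one_le_exp (η - 1)
      have e : ((2 : ℕ) : ℝ) * ((η - 1) / 2) = η - 1 := by push_cast; ring
      rw [e]
      linarith
    rw [h1]
    refine (pow_le_pow_left₀ (Real.sqrt_nonneg _) h2 n).trans (le_of_eq ?_)
    rw [← Real.exp_nat_mul]
    ring_nf
  set X := -(r ^ 2 * n * η) + (r ^ 2 * n + 3 * r ^ 3 * b ^ 4) * η ^ 2 / 2 +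
    16 / 9 * r ^ 3 * b ^ 6 with hX
  have hE : 1 - r ^ 2 * n / (1 - r ^ 2) + (r ^ 2 * n + 3 * r ^ 3 * b ^ 4) /
      (2 * (1 - r ^ 2) ^ 2) + 16 / 9 * r ^ 3 * b ^ 6 = X + 1 := by
    rw [hX, hη]; field_simp; ring
  rw [hE]
  refine (mul_le_mul hD (Real.add_one_le_exp X) ?_ (Real.exp_nonneg _)).trans ?_
  · have e1 : r ^ 2 * n * η ≤ 1 := by
      have : r ^ 2 * n ≤ 1 / 4 := by
        have : r * n ≤ 1 / 2 := (mul_le_mul_of_nonneg_left hn hr.le).trans hrb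
        nlinarith
      nlinarith
    have e2 : 0 ≤ (r ^ 2 * n + 3 * r ^ 3 * b ^ 4) * η ^ 2 / 2 + 16 / 9 * r ^ 3 * b ^ 6 := by
      positivity
    rw [hX]; linarith
  · rw [← Real.exp_add, Real.exp_le_exp, hX]
    have hη4 : η ^ 2 ≤ 16 / 9 := by nlinarith
    -- The decisive cancellation: normalisation, squared norms and squared inner product contribute
    -- at order `r ^ 2` with weights `1/2`, `-1` and `1/2`. The remainder is of order `r ^ 4`.
    have e0 : n * (r ^ 2 * η) / 2 - r ^ 2 * n * η + r ^ 2 * n * η ^ 2 / 2 =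
        r ^ 4 * n * η ^ 2 / 2 := by
      have : η = 1 + r ^ 2 * η := by linarith
      calc n * (r ^ 2 * η) / 2 - r ^ 2 * n * η + r ^ 2 * n * η ^ 2 / 2
          = n * r ^ 2 * η * (η - 1) / 2 := by ring
        _ = _ := by rw [hη2]; ring
    have hb46 : b ^ 4 ≤ b ^ 6 := pow_le_pow_right₀ hb (by norm_num)
    have hb26 : b ^ 2 ≤ b ^ 6 := pow_le_pow_right₀ hb (by norm_num)
    have hr3 : 0 < r ^ 3 := by positivity
    have e1 : r ^ 4 * n * η ^ 2 / 2 ≤ 4 / 9 * (r ^ 3 * b ^ 6) := by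
      calc r ^ 4 * n * η ^ 2 / 2 = r ^ 3 * (r * n) * η ^ 2 / 2 := by ring
        _ ≤ r ^ 3 * (1 / 2 * b ^ 6) * (16 / 9) / 2 := by
          gcongr
          exact hn.trans hb26
        _ = _ := by ring
    have e2 : 3 * r ^ 3 * b ^ 4 * η ^ 2 / 2 ≤ 8 / 3 * (r ^ 3 * b ^ 6) := by
      calc 3 * r ^ 3 * b ^ 4 * η ^ 2 / 2 ≤ 3 * r ^ 3 * b ^ 6 * (16 / 9) / 2 := by gcongr
        _ = _ := by ring
    -- The constants add up to `4/9 + 8/3 + 16/9 = 44/9`, below `5`.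
    have e3 : 0 ≤ r ^ 3 * b ^ 6 := by positivity
    nlinarith

/-- The second moment of the relative density of `√r X + √(1 - r) g`, where `X` is centred, bounded
and isotropic: it exceeds `1` only to third order in `r`. -/
theorem lintegral_mixPDF_sq_div_le {X : S → Fin n → ℝ} (hX : Measurable X) {r b : ℝ} (hr : 0 < r)
    (hb : 1 ≤ b) (hrb : r * b ^ 2 ≤ 1 / 2) (hvr : (v : ℝ) = 1 - r) (hn : (n : ℝ) ≤ b ^ 2)
    (hXb : ∀ᵐ s ∂Q, ∑ i, X s i ^ 2 ≤ b ^ 2) (hX0 : ∀ i, ∫ s, X s i ∂Q = 0)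
    (hX1 : ∀ i j, ∫ s, X s i * X s j ∂Q = if i = j then 1 else 0) :
    ∫⁻ x, ENNReal.ofReal (mixPDF Q v (fun s => √r • X s) x ^ 2 / stdPDF x) ≤
      ENNReal.ofReal (Real.exp (5 * r ^ 3 * b ^ 6)) := by
  have hb2 : 1 ≤ b ^ 2 := one_le_pow₀ hb
  have hr2 : r ≤ 1 / 2 := by nlinarith
  have hXi : ∀ i, Measurable fun s => X s i := fun i => (measurable_pi_apply i).comp hX
  have hle : ∀ᵐ s ∂Q, ∀ i, |X s i| ≤ b := by
    filter_upwards [hXb] with s hs i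
    refine abs_le_of_sq_le_sq ?_ (by linarith)
    exact (Finset.single_le_sum (f := fun i => X s i ^ 2) (fun i _ => sq_nonneg _)
      (Finset.mem_univ i)).trans hs
  have hI1 : ∀ i, Integrable (fun s => X s i) Q := fun i =>
    (integrable_const b).mono' (hXi i).aestronglyMeasurable (hle.mono fun s h => h i)
  have hI2 : ∀ i j, Integrable (fun s => X s i * X s j) Q := fun i j =>
    (integrable_const (b * b)).mono' ((hXi i).mul (hXi j)).aestronglyMeasurable
      (hle.mono fun s h => by
        rw [norm_mul]
        exact mul_le_mul (h i) (h j) (norm_nonneg _) (by linarith))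
  have hI3 : ∀ i, Integrable (fun s => X s i ^ 2) Q := fun i => by simpa only [sq] using hI2 i i
  have hAm : Measurable fun s => √r • X s := hX.const_smul (√r)
  rw [lintegral_mixPDF_sq_div hr (by linarith) hvr hAm]
  set u : S × S → ℝ := fun w => ∑ i, X w.1 i * X w.2 i with hu
  set N : S × S → ℝ := fun w => (∑ i, X w.1 i ^ 2) + ∑ i, X w.2 i ^ 2 with hN
  have huI : Integrable u (Q.prod Q) :=
    integrable_finsetSum _ fun i _ => (hI1 i).mul_prod (hI1 i)
  have hNI1 : Integrable (fun w : S × S => ∑ i, X w.1 i ^ 2) (Q.prod Q) :=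
    (integrable_finsetSum _ fun i _ => hI3 i).comp_fst Q
  have hNI2 : Integrable (fun w : S × S => ∑ i, X w.2 i ^ 2) (Q.prod Q) :=
    (integrable_finsetSum _ fun i _ => hI3 i).comp_snd Q
  -- Centring removes the first-order term.
  have hu0 : ∫ w, u w ∂(Q.prod Q) = 0 := by
    rw [hu, integral_finsetSum _ fun i _ => (hI1 i).mul_prod (hI1 i)]
    refine Finset.sum_eq_zero fun i _ => ?_
    rw [integral_prod_mul (fun s => X s i) fun s => X s i, hX0, zero_mul]
  have hsq : ∫ s, ∑ i, X s i ^ 2 ∂Q = n := by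
    rw [integral_finsetSum _ fun i _ => hI3 i]
    simp only [sq, hX1]
    simp
  have hN0 : ∫ w, N w ∂(Q.prod Q) = 2 * n := by
    rw [hN, integral_add hNI1 hNI2, integral_fun_fst (fun s => ∑ i, X s i ^ 2),
      integral_fun_snd (fun s => ∑ i, X s i ^ 2), hsq]
    simp
    ring
  have hu2e : ∀ w, u w ^ 2 = ∑ i, ∑ j, (X w.1 i * X w.1 j) * (X w.2 i * X w.2 j) := by
    intro w
    rw [hu, sq, Finset.sum_mul_sum]
    exact Finset.sum_congr rfl fun i _ => Finset.sum_congr rfl fun j _ => by ring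
  have hu2I : Integrable (fun w => u w ^ 2) (Q.prod Q) := by
    simp only [hu2e]
    exact integrable_finsetSum _ fun i _ => integrable_finsetSum _ fun j _ =>
      (hI2 i j).mul_prod (hI2 i j)
  -- By independence of the copies this is the sum of the squared covariances, hence the trace of
  -- the identity.
  have hu2 : ∫ w, u w ^ 2 ∂(Q.prod Q) = n := by
    simp only [hu2e]
    rw [integral_finsetSum _ fun i _ => integrable_finsetSum _ fun j _ =>
      (hI2 i j).mul_prod (hI2 i j)]
    have hij : ∀ i, ∫ w : S × S, ∑ j, (X w.1 i * X w.1 j) * (X w.2 i * X w.2 j) ∂(Q.prod Q) = 1 := by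
      intro i
      rw [integral_finsetSum _ fun j _ => (hI2 i j).mul_prod (hI2 i j)]
      have : ∀ j, ∫ w : S × S, (X w.1 i * X w.1 j) * (X w.2 i * X w.2 j) ∂(Q.prod Q) =
          if i = j then 1 else 0 := by
        intro j
        rw [integral_prod_mul (fun s => X s i * X s j) fun s => X s i * X s j, hX1]
        split_ifs <;> simp
      simp [this]
    simp [hij]
  have hb1 : ∀ᵐ w ∂(Q.prod Q), ∑ i, X w.1 i ^ 2 ≤ b ^ 2 :=
    Measure.quasiMeasurePreserving_fst.ae hXb
  have hb2' : ∀ᵐ w ∂(Q.prod Q), ∑ i, X w.2 i ^ 2 ≤ b ^ 2 :=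
    Measure.quasiMeasurePreserving_snd.ae hXb
  set G : S × S → ℝ := fun w => 1 + (r * u w - r ^ 2 * N w / 2) / (1 - r ^ 2) +
    (r ^ 2 * u w ^ 2 + 3 * r ^ 3 * b ^ 4) / (2 * (1 - r ^ 2) ^ 2) + 16 / 9 * r ^ 3 * b ^ 6 with hG
  have hNI : Integrable N (Q.prod Q) := hNI1.add hNI2
  have hA1 : Integrable (fun w => (r * u w - r ^ 2 * N w / 2) / (1 - r ^ 2)) (Q.prod Q) :=
    ((huI.const_mul r).sub ((hNI.const_mul (r ^ 2)).div_const 2)).div_const _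
  have hA2 : Integrable (fun w => (r ^ 2 * u w ^ 2 + 3 * r ^ 3 * b ^ 4) /
      (2 * (1 - r ^ 2) ^ 2)) (Q.prod Q) :=
    ((hu2I.const_mul (r ^ 2)).add (integrable_const _)).div_const _
  have hA0 : Integrable (fun w => 1 + (r * u w - r ^ 2 * N w / 2) / (1 - r ^ 2)) (Q.prod Q) :=
    (integrable_const _).add hA1
  have hGI : Integrable G (Q.prod Q) := (hA0.add hA2).add (integrable_const _)
  have hGv : ∫ w, G w ∂(Q.prod Q) = 1 - r ^ 2 * n / (1 - r ^ 2) +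
      (r ^ 2 * n + 3 * r ^ 3 * b ^ 4) / (2 * (1 - r ^ 2) ^ 2) + 16 / 9 * r ^ 3 * b ^ 6 := by
    rw [hG, integral_add (by exact hA0.add hA2) (integrable_const _), integral_add hA0 hA2,
      integral_add (integrable_const _) hA1, integral_div, integral_div,
      integral_sub (huI.const_mul r) ((hNI.const_mul (r ^ 2)).div_const 2), integral_div,
      integral_const_mul, integral_const_mul, integral_add (hu2I.const_mul (r ^ 2))
      (integrable_const _), integral_const_mul, hu0, hN0, hu2]
    simp
    ring
  have hDnn : 0 ≤ (√(1 - r ^ 2))⁻¹ ^ n := by positivity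
  -- The second conjunct, which the passage to a real integral needs, is free: `G` dominates an
  -- exponential.
  have hpt : ∀ᵐ w ∂(Q.prod Q), (√(1 - r ^ 2))⁻¹ ^ n *
      Real.exp ((2 * (∑ i, (√r • X w.1) i * (√r • X w.2) i) -
        r * ((∑ i, (√r • X w.1) i ^ 2) + ∑ i, (√r • X w.2) i ^ 2)) / (2 * (1 - r ^ 2))) ≤
      (√(1 - r ^ 2))⁻¹ ^ n * G w ∧ 0 ≤ G w := by
    filter_upwards [hb1, hb2'] with w h1 h2
    have e1 : ∑ i, (√r • X w.1) i * (√r • X w.2) i = r * u w := by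
      rw [hu, Finset.mul_sum]
      refine Finset.sum_congr rfl fun i _ => ?_
      simp only [Pi.smul_apply, smul_eq_mul]
      rw [mul_mul_mul_comm, Real.mul_self_sqrt hr.le]
    have e2 : ∀ x : Fin n → ℝ, ∑ i, (√r • x) i ^ 2 = r * ∑ i, x i ^ 2 := by
      intro x
      rw [Finset.mul_sum]
      refine Finset.sum_congr rfl fun i _ => ?_
      simp only [Pi.smul_apply, smul_eq_mul]
      rw [mul_pow, Real.sq_sqrt hr.le]
    have hNn : 0 ≤ N w := add_nonneg (Finset.sum_nonneg fun i _ => sq_nonneg _)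
      (Finset.sum_nonneg fun i _ => sq_nonneg _)
    have hNb : N w ≤ 2 * b ^ 2 := by rw [two_mul]; exact add_le_add h1 h2
    have hub : |u w| ≤ b ^ 2 := by
      refine abs_le_of_sq_le_sq ?_ (by positivity)
      calc u w ^ 2 ≤ (∑ i, X w.1 i ^ 2) * ∑ i, X w.2 i ^ 2 :=
            Finset.sum_mul_sq_le_sq_mul_sq _ _ _
        _ ≤ b ^ 2 * b ^ 2 := mul_le_mul h1 h2 (Finset.sum_nonneg fun i _ => sq_nonneg _)
            (by positivity)
        _ = _ := by ring
    have key := mehler_pointwise_bound hr hb hrb hub hNn hNb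
    rw [e1, e2, e2, ← mul_add]
    exact ⟨mul_le_mul_of_nonneg_left key hDnn, (Real.exp_nonneg _).trans key⟩
  refine (lintegral_mono_ae (hpt.mono fun w h => ENNReal.ofReal_le_ofReal h.1)).trans ?_
  rw [← ofReal_integral_eq_lintegral_ofReal (hGI.const_mul _)
    (hpt.mono fun w h => mul_nonneg hDnn h.2), integral_const_mul, hGv]
  exact ENNReal.ofReal_le_ofReal (mehler_normalisation_bound hr hb hrb hn)

end MixPDF

/-! ### The Wasserstein distance: upper bounds by couplings and the triangle inequality. -/

section Wasserstein

variable {E : Type*} [NormedAddCommGroup E] [MeasurableSpace E]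

/-- The square root is an order isomorphism of `[0, ∞]`, so it commutes with infima. In this form
the triangle inequality can be checked one pair of couplings at a time. -/
theorem W2_eq_iInf (μ ν : Measure E) :
    W2 μ ν = ⨅ γ ∈ couplings μ ν, (∫⁻ p, ‖p.1 - p.2‖ₑ ^ 2 ∂γ) ^ (1 / 2 : ℝ) := by
  have h := fun s : ℝ≥0∞ => ENNReal.orderIsoRpow_apply (1 / 2) (by norm_num) s
  unfold W2
  simp only [← h, OrderIso.map_iInf]

theorem W2_le_of_coupling {μ ν : Measure E} {γ : Measure (E × E)} (h : γ ∈ couplings μ ν) :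
    W2 μ ν ≤ (∫⁻ p, ‖p.1 - p.2‖ₑ ^ 2 ∂γ) ^ (1 / 2 : ℝ) := by
  rw [W2_eq_iInf]
  exact iInf₂_le γ h

variable [BorelSpace E] [SecondCountableTopology E]

theorem W2_map_le {Ω : Type*} [MeasurableSpace Ω] (P : Measure Ω) {X Y : Ω → E}
    (hX : Measurable X) (hY : Measurable Y) {C : ℝ} (hC : 0 ≤ C)
    (h : ∫⁻ ω, ‖X ω - Y ω‖ₑ ^ 2 ∂P ≤ ENNReal.ofReal (C ^ 2)) :
    W2 (P.map X) (P.map Y) ≤ ENNReal.ofReal C := by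
  refine (W2_le_of_coupling (γ := P.map fun ω => (X ω, Y ω)) ⟨?_, ?_⟩).trans ?_
  · rw [Measure.map_map measurable_fst (hX.prodMk hY)]; rfl
  · rw [Measure.map_map measurable_snd (hX.prodMk hY)]; rfl
  rw [lintegral_map (by fun_prop) (hX.prodMk hY)]
  refine (ENNReal.rpow_le_rpow h (by norm_num)).trans (le_of_eq ?_)
  rw [ENNReal.ofReal_rpow_of_nonneg (sq_nonneg C) (by norm_num), ← Real.sqrt_eq_rpow,
    Real.sqrt_sq hC]

theorem W2_self (μ : Measure E) : W2 μ μ = 0 := by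
  have h := W2_map_le μ measurable_id measurable_id le_rfl (by simp)
  simpa using h

variable [StandardBorelSpace E]

/-- The triangle inequality for `W2`, by gluing two couplings along their common marginal. -/
theorem W2_triangle (μ ν ξ : Measure E) [IsProbabilityMeasure ν] :
    W2 μ ξ ≤ W2 μ ν + W2 ν ξ := by
  rw [W2_eq_iInf μ ν, W2_eq_iInf ν ξ]
  refine ENNReal.le_iInf₂_add_iInf₂ fun γ₁ h₁ γ₂ h₂ => ?_
  have hE : Nonempty E := ⟨0⟩
  have hp₁ : IsProbabilityMeasure γ₁ := by
    refine ⟨?_⟩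
    rw [← preimage_univ (f := Prod.snd), ← Measure.map_apply measurable_snd MeasurableSet.univ,
      h₁.2, measure_univ]
  have hp₂ : IsProbabilityMeasure γ₂ := by
    refine ⟨?_⟩
    rw [← preimage_univ (f := Prod.fst), ← Measure.map_apply measurable_fst MeasurableSet.univ,
      h₂.1, measure_univ]
  -- Swapping puts the common marginal `ν` first in both couplings, ready for disintegration.
  set γ' := γ₁.map Prod.swap with hγ'
  have hp' : IsProbabilityMeasure γ' :=
    Measure.isProbabilityMeasure_map measurable_swap.aemeasurable
  have hfst' : γ'.fst = ν := by
    rw [Measure.fst, hγ', Measure.map_map measurable_fst measurable_swap]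
    exact h₁.2
  have hfst₂ : γ₂.fst = ν := h₂.1
  have hd' : ν ⊗ₘ γ'.condKernel = γ' := by rw [← hfst']; exact γ'.disintegrate γ'.condKernel
  have hd₂ : ν ⊗ₘ γ₂.condKernel = γ₂ := by rw [← hfst₂]; exact γ₂.disintegrate γ₂.condKernel
  -- The gluing: given the middle point, the outer points are drawn independently from the two
  -- conditional laws.
  set π := ν ⊗ₘ (γ'.condKernel ×ₖ γ₂.condKernel) with hπ
  have hlint : ∀ f : E × E → ℝ≥0∞, Measurable f →
      ∫⁻ w, f (w.2.1, w.1) ∂π = ∫⁻ p, f p ∂γ₁ := by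
    intro f hf
    have h3 : ∫⁻ p, f p ∂γ₁ = ∫⁻ p, f p.swap ∂γ' := by
      rw [hγ', lintegral_map (by exact hf.comp measurable_swap) measurable_swap]
      simp
    have hsw : Measurable fun p : E × E => f p.swap := hf.comp measurable_swap
    rw [h3, ← hd', hπ, Measure.lintegral_compProd (by fun_prop), Measure.lintegral_compProd hsw]
    refine lintegral_congr fun a => ?_
    have hm : Measurable fun b : E => f (b, a) := hf.comp (by fun_prop)
    rw [Kernel.prod_apply, lintegral_prod _ (by exact (hm.comp measurable_fst).aemeasurable)]
    simp
  have hlint₂ : ∀ f : E × E → ℝ≥0∞, Measurable f →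
      ∫⁻ w, f (w.1, w.2.2) ∂π = ∫⁻ p, f p ∂γ₂ := by
    intro f hf
    rw [← hd₂, Measure.lintegral_compProd hf, hπ,
      Measure.lintegral_compProd (by fun_prop)]
    refine lintegral_congr fun a => ?_
    have hm : Measurable fun b : E => f (a, b) := hf.comp (by fun_prop)
    rw [Kernel.prod_apply, lintegral_prod _ (by exact (hm.comp measurable_snd).aemeasurable)]
    simp
  have hcoup : π.map Prod.snd ∈ couplings μ ξ := by
    constructor
    · refine Measure.ext_of_lintegral _ fun f hf => ?_
      rw [Measure.map_map measurable_fst measurable_snd,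
        lintegral_map hf (measurable_fst.comp measurable_snd), ← h₁.1,
        lintegral_map hf measurable_fst]
      exact hlint (fun p => f p.1) (hf.comp measurable_fst)
    · refine Measure.ext_of_lintegral _ fun f hf => ?_
      rw [Measure.map_map measurable_snd measurable_snd,
        lintegral_map hf (measurable_snd.comp measurable_snd), ← h₂.2,
        lintegral_map hf measurable_snd]
      exact hlint₂ (fun p => f p.2) (hf.comp measurable_snd)
  refine (W2_le_of_coupling hcoup).trans ?_
  rw [lintegral_map (by fun_prop) measurable_snd,
    ← hlint (fun p => ‖p.1 - p.2‖ₑ ^ 2) (by fun_prop),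
    ← hlint₂ (fun p => ‖p.1 - p.2‖ₑ ^ 2) (by fun_prop)]
  simp only [← ENNReal.rpow_two]
  refine le_trans (ENNReal.rpow_le_rpow (lintegral_mono fun w => ENNReal.rpow_le_rpow ?_
    (by norm_num)) (by norm_num)) (ENNReal.lintegral_Lp_add_le
      (f := fun w : E × E × E => ‖w.2.1 - w.1‖ₑ) (g := fun w => ‖w.1 - w.2.2‖ₑ)
      (by fun_prop) (by fun_prop) (by norm_num))
  have : w.2.1 - w.2.2 = (w.2.1 - w.1) + (w.1 - w.2.2) := by abel
  rw [this]
  exact enorm_add_le _ _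

/-- The triangle inequality along a chain of measures. -/
theorem W2_chain_le (M : ℕ → Measure E) [∀ k, IsProbabilityMeasure (M k)] (b : ℕ → ℝ)
    (hb : ∀ k, 0 ≤ b k) (K : ℕ) (h : ∀ k < K, W2 (M (k + 1)) (M k) ≤ ENNReal.ofReal (b k)) :
    W2 (M K) (M 0) ≤ ENNReal.ofReal (∑ k ∈ Finset.range K, b k) := by
  induction K with
  | zero => simp [W2_self]
  | succ K ih =>
    rw [Finset.sum_range_succ, add_comm (∑ k ∈ Finset.range K, b k), ENNReal.ofReal_add (hb K)
      (Finset.sum_nonneg fun k _ => hb k)]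
    exact (W2_triangle _ (M K) _).trans (add_le_add (h K (Nat.lt_succ_self K))
      (ih fun k hk => h k (hk.trans (Nat.lt_succ_self K))))

end Wasserstein

/-! ### Laws of walks driven by independent samples. -/

section WalkLaw

theorem walk_congr {E : Type*} [NormedAddCommGroup E] [NormedSpace ℝ E] {δ : ℝ} {β z₀ : E} {F G : ℕ → E → E} {k : ℕ} (h : ∀ j < k, F j = G j) :
    walk δ β z₀ F k = walk δ β z₀ G k := by
  induction k with
  | zero => rfl
  | succ k ih =>
    simp only [walk]
    rw [ih fun j hj => h j (hj.trans (Nat.lt_succ_self k)), h k (Nat.lt_succ_self k)]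

variable {E : Type*} [NormedAddCommGroup E] [NormedSpace ℝ E] [MeasurableSpace E] [BorelSpace E]
  [SecondCountableTopology E] {S : Type*} [MeasurableSpace S]

theorem measurable_walk {F : S → E → E} (hF : Measurable (Function.uncurry F)) (δ : ℝ) (β z₀ : E)
    {α : Type*} [MeasurableSpace α] {s : α → ℕ → S} (hs : ∀ j, Measurable fun a => s a j) (k : ℕ) :
    Measurable fun a => walk δ β z₀ (fun j => F (s a j)) k := by
  induction k with
  | zero => exact measurable_const
  | succ k ih =>
    simp only [walk]
    have h : Measurable fun a => F (s a k) (walk δ β z₀ (fun j => F (s a j)) k) :=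
      hF.comp ((hs k).prodMk ih)
    exact (ih.add_const _).add (h.const_smul (√δ))

variable {Ω : Type*} [MeasurableSpace Ω] {P : Measure Ω} [IsProbabilityMeasure P]

/-- The law of a walk driven by independent samples of a random field satisfies a Markov
recursion. -/
theorem map_walk_succ {Q : Measure S} [IsProbabilityMeasure Q] {F : S → E → E}
    (hF : Measurable (Function.uncurry F)) {σ : ℕ → Ω → S} (hσ : iIndepFun σ P)
    (hσQ : ∀ k, HasLaw (σ k) Q P) (δ : ℝ) (β z₀ : E) (k : ℕ) :
    AEMeasurable (fun ω => walk δ β z₀ (fun j => F (σ j ω)) k) P ∧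
    P.map (fun ω => walk δ β z₀ (fun j => F (σ j ω)) (k + 1)) =
      ((P.map fun ω => walk δ β z₀ (fun j => F (σ j ω)) k).prod Q).map
        (fun w => w.1 + δ • β + √δ • F w.2 w.1) := by
  obtain ⟨s₀⟩ : Nonempty S := nonempty_of_isProbabilityMeasure Q
  have hm : ∀ j, AEMeasurable (σ j) P := fun j => (hσQ j).aemeasurable
  -- The walk at time `k` reads only the first `k` samples; the padding value `s₀` is never used.
  -- This exhibits it as a measurable function of those samples, hence independent of `σ k`.
  let ext : (Finset.range k → S) → ℕ → S := fun x j =>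
    if h : j < k then x ⟨j, Finset.mem_range.2 h⟩ else s₀
  have hext : ∀ j, Measurable fun x => ext x j := by
    intro j
    by_cases h : j < k
    · simp only [ext, h, dif_pos]; fun_prop
    · simp only [ext, h, dif_neg, not_false_eq_true]; fun_prop
  have hφ : Measurable fun x => walk δ β z₀ (fun j => F (ext x j)) k :=
    measurable_walk hF δ β z₀ hext k
  have hwalk : (fun ω => walk δ β z₀ (fun j => F (σ j ω)) k) =
      (fun x => walk δ β z₀ (fun j => F (ext x j)) k) ∘
        fun ω (i : Finset.range k) => σ i ω := by
    funext ω
    refine walk_congr fun j hj => ?_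
    simp only [ext, hj, dif_pos]
  have hind := (hσ.indepFun_finset₀ (Finset.range k) {k} (by simp) hm).comp hφ
    (measurable_pi_apply (⟨k, Finset.mem_singleton_self k⟩ : ({k} : Finset ℕ)))
  rw [← hwalk] at hind
  have hwm : AEMeasurable (fun ω => walk δ β z₀ (fun j => F (σ j ω)) k) P := by
    rw [hwalk]
    exact hφ.comp_aemeasurable (aemeasurable_pi_lambda _ fun i => hm i)
  refine ⟨hwm, ?_⟩
  have hprod := (indepFun_iff_map_prod_eq_prod_map_map hwm (hm k)).1 hind
  have hstep : Measurable fun w : E × S => w.1 + δ • β + √δ • F w.2 w.1 :=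
    (measurable_fst.add_const _).add ((hF.comp measurable_swap).const_smul (√δ))
  rw [(hσQ k).map_eq] at hprod
  rw [← hprod, AEMeasurable.map_map_of_aemeasurable hstep.aemeasurable (hwm.prodMk (hm k))]
  rfl

end WalkLaw

/-! ### Sums of independent Gaussian vectors. -/

section Gaussian

variable {E : Type*} [NormedAddCommGroup E] [InnerProductSpace ℝ E] [FiniteDimensional ℝ E]
  [MeasurableSpace E] [BorelSpace E]

/-- Characteristic functions multiply under convolution, and the quadratic exponents add. -/
theorem map_smul_add_smul_stdGaussian {a b c : ℝ} (h : a ^ 2 + b ^ 2 = c ^ 2) :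
    ((stdGaussian E).prod (stdGaussian E)).map (fun w => a • w.1 + b • w.2) =
      (stdGaussian E).map (fun g => c • g) := by
  have hc : ((stdGaussian E).prod (stdGaussian E)).map (fun w => a • w.1 + b • w.2) =
      ((stdGaussian E).map (a • ·)).conv ((stdGaussian E).map (b • ·)) := by
    rw [Measure.conv, Measure.map_prod_map _ _ (by fun_prop) (by fun_prop),
      Measure.map_map (by fun_prop) (by fun_prop)]
    rfl
  rw [hc]
  refine Measure.ext_of_charFun ?_
  funext t
  rw [charFun_conv, charFun_map_smul, charFun_map_smul, charFun_map_smul, charFun_stdGaussian,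
    charFun_stdGaussian, charFun_stdGaussian, ← Complex.exp_add]
  congr 1
  simp only [norm_smul, mul_pow, Real.norm_eq_abs, Complex.ofReal_mul, ← Complex.ofReal_pow, sq_abs]
  have : ((c ^ 2 : ℝ) : ℂ) = (a ^ 2 : ℝ) + (b ^ 2 : ℝ) := by exact_mod_cast h.symm
  norm_cast
  rw [← h]
  ring_nf

theorem lintegral_add_smul_add_smul_stdGaussian {a b c : ℝ} (h : a ^ 2 + b ^ 2 = c ^ 2)
    {f : E → ℝ≥0∞} (hf : Measurable f) (z : E) :
    ∫⁻ g, ∫⁻ g', f (z + a • g + b • g') ∂(stdGaussian E) ∂(stdGaussian E) =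
      ∫⁻ g, f (z + c • g) ∂(stdGaussian E) := by
  have hm : Measurable fun g => f (z + g) := hf.comp (by fun_prop)
  rw [← lintegral_map (f := fun g => f (z + g)) hm (by fun_prop : Measurable fun g : E => c • g),
    ← map_smul_add_smul_stdGaussian h, lintegral_map hm (by fun_prop),
    lintegral_prod _ (by fun_prop)]
  simp only [add_assoc]

end Gaussian

/-! ### Isotropic fields and the dimension bound. -/

/-- A random vector field that is bounded, centred and isotropic at every point. -/
structure IsotropicField {d : ℕ} {S : Type*} [MeasurableSpace S] (Q : Measure S)
    (H : S → EuclideanSpace ℝ (Fin d) → EuclideanSpace ℝ (Fin d)) (b : ℝ) : Prop where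
  measurable : Measurable (Function.uncurry H)
  bound : ∀ᵐ s ∂Q, ∀ u, ‖H s u‖ ≤ b
  mean : ∀ u, ∫ s, H s u ∂Q = 0
  cov : ∀ u i j, ∫ s, H s u i * H s u j ∂Q = if i = j then 1 else 0

namespace IsotropicField

variable {d : ℕ} {S : Type*} [MeasurableSpace S] {Q : Measure S}
  {H : S → EuclideanSpace ℝ (Fin d) → EuclideanSpace ℝ (Fin d)} {b : ℝ}

theorem measurable_apply (h : IsotropicField Q H b) (u : EuclideanSpace ℝ (Fin d)) :
    Measurable fun s => H s u :=
  h.measurable.comp measurable_prodMk_right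

theorem sum_sq_le (h : IsotropicField Q H b) (u : EuclideanSpace ℝ (Fin d)) :
    ∀ᵐ s ∂Q, ∑ i, (H s u) i ^ 2 ≤ b ^ 2 := by
  filter_upwards [h.bound] with s hs
  rw [← EuclideanSpace.real_norm_sq_eq]
  exact pow_le_pow_left₀ (norm_nonneg _) (hs u) 2

variable [IsProbabilityMeasure Q]

theorem nonneg (h : IsotropicField Q H b) : 0 ≤ b := by
  obtain ⟨s, hs⟩ := h.bound.exists
  exact (norm_nonneg _).trans (hs 0)

theorem integral_coord (h : IsotropicField Q H b) (u : EuclideanSpace ℝ (Fin d)) (i : Fin d) :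
    ∫ s, H s u i ∂Q = 0 := by
  have hi : Integrable (fun s => H s u) Q :=
    (integrable_const b).mono' (h.measurable_apply u).aestronglyMeasurable
      (h.bound.mono fun s hs => hs u)
  have h1 := (EuclideanSpace.proj (𝕜 := ℝ) i).integral_comp_comm hi
  rw [h.mean, map_zero] at h1
  exact h1

/-- The trace of the covariance is the mean squared norm. This is how all estimates become
independent of the dimension. -/
theorem dim_le (h : IsotropicField Q H b) : (d : ℝ) ≤ b ^ 2 := by
  have hm : ∀ i, Measurable fun s => H s 0 i := fun i =>
    (EuclideanSpace.proj (𝕜 := ℝ) i).continuous.measurable.comp (h.measurable_apply 0)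
  have hi : ∀ i, Integrable (fun s => (H s 0) i ^ 2) Q := fun i =>
    (integrable_const (b ^ 2)).mono' ((hm i).pow_const 2).aestronglyMeasurable
      ((h.sum_sq_le 0).mono fun s hs => by
        rw [Real.norm_of_nonneg (sq_nonneg _)]
        exact (Finset.single_le_sum (f := fun i => (H s 0) i ^ 2) (fun i _ => sq_nonneg _)
          (Finset.mem_univ i)).trans hs)
  have h1 := integral_mono_ae (integrable_finsetSum Finset.univ fun i _ => hi i)
    (integrable_const (b ^ 2)) (h.sum_sq_le 0)
  rw [integral_finsetSum _ fun i _ => hi i] at h1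
  simpa [sq, h.cov] using h1

theorem one_le (h : IsotropicField Q H b) (hd : d ≠ 0) : 1 ≤ b := by
  have h1 : (1 : ℝ) ≤ d := by exact_mod_cast Nat.one_le_iff_ne_zero.2 hd
  have h2 := h.dim_le
  have h3 := h.nonneg
  nlinarith

end IsotropicField

/-! ### The cost of replacing one step. -/

section OneStep

variable {d : ℕ}

theorem lintegral_enorm_sq_stdGaussian :
    ∫⁻ g, ‖g‖ₑ ^ 2 ∂(stdGaussian (EuclideanSpace ℝ (Fin d))) = d := by
  have h1 : ∀ x : Fin d → ℝ, ‖WithLp.toLp 2 x‖ₑ ^ 2 = ∑ i, ENNReal.ofReal (x i ^ 2) := by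
    intro x
    rw [← ofReal_norm, ← ENNReal.ofReal_pow (norm_nonneg _), EuclideanSpace.real_norm_sq_eq,
      ENNReal.ofReal_sum_of_nonneg fun i _ => sq_nonneg _]
  have h2 : ∫⁻ y : ℝ, ENNReal.ofReal (y ^ 2) ∂(gaussianReal 0 1) = 1 := by
    have hi : Integrable (fun y : ℝ => y ^ 2) (gaussianReal 0 1) :=
      (memLp_id_gaussianReal 2).integrable_sq
    rw [← ofReal_integral_eq_lintegral_ofReal hi
      (ae_of_all _ fun y => sq_nonneg _)]
    have := variance_fun_id_gaussianReal (μ := 0) (v := 1)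
    rw [variance_eq_integral (by fun_prop)] at this
    simp only [integral_id_gaussianReal, sub_zero, NNReal.coe_one] at this
    simp [this]
  rw [← map_pi_eq_stdGaussian, lintegral_map (by fun_prop) (by fun_prop)]
  simp only [h1]
  rw [lintegral_finsetSum _ fun i _ => by fun_prop]
  have h3 : ∀ i : Fin d, ∫⁻ x : Fin d → ℝ, ENNReal.ofReal (x i ^ 2)
      ∂(Measure.pi fun _ => gaussianReal 0 1) = 1 := by
    intro i
    rw [← h2, ← (measurePreserving_eval (fun _ : Fin d => gaussianReal 0 1) i).lintegral_comp
      (by fun_prop : Measurable fun y : ℝ => ENNReal.ofReal (y ^ 2))]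
  simp [h3]

variable {S : Type*} [MeasurableSpace S] {Q : Measure S} [IsProbabilityMeasure Q]
  {H : S → EuclideanSpace ℝ (Fin d) → EuclideanSpace ℝ (Fin d)} {b : ℝ}
  {ν : Measure (EuclideanSpace ℝ (Fin d))}

theorem measurable_step (hH : Measurable (Function.uncurry H)) (e : EuclideanSpace ℝ (Fin d))
    (r : ℝ) : Measurable fun w : EuclideanSpace ℝ (Fin d) × S => w.1 + e + r • H w.2 w.1 :=
  (measurable_fst.add_const _).add ((hH.comp measurable_swap).const_smul r)

theorem lintegral_map_gaussian (e : EuclideanSpace ℝ (Fin d)) (t : ℝ)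
    {f : EuclideanSpace ℝ (Fin d) → ℝ≥0∞} (hf : Measurable f) :
    ∫⁻ x, f x ∂((ν.prod (stdGaussian (EuclideanSpace ℝ (Fin d)))).map
      fun w => w.1 + e + t • w.2) =
    ∫⁻ z, ∫⁻ g, f (z + e + t • g) ∂(stdGaussian (EuclideanSpace ℝ (Fin d))) ∂ν := by
  rw [lintegral_map hf (by fun_prop), lintegral_prod _ (by fun_prop)]

variable [IsProbabilityMeasure ν]

theorem lintegral_map_step (hH : Measurable (Function.uncurry H))
    (e c : EuclideanSpace ℝ (Fin d)) (r t : ℝ) {f : EuclideanSpace ℝ (Fin d) → ℝ≥0∞}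
    (hf : Measurable f) :
    ∫⁻ x, f x ∂((((ν.prod Q).map fun w => w.1 + e + r • H w.2 w.1).prod
      (stdGaussian (EuclideanSpace ℝ (Fin d)))).map fun w => w.1 + c + t • w.2) =
    ∫⁻ z, ∫⁻ s, ∫⁻ g, f (z + e + r • H s z + c + t • g)
      ∂(stdGaussian (EuclideanSpace ℝ (Fin d))) ∂Q ∂ν := by
  have hstep := measurable_step hH e r
  have := Measure.isProbabilityMeasure_map (μ := ν.prod Q) hstep.aemeasurable
  have hg : Measurable fun w : EuclideanSpace ℝ (Fin d) × EuclideanSpace ℝ (Fin d) =>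
    f (w.1 + c + t • w.2) := by fun_prop
  have hG : Measurable fun x : EuclideanSpace ℝ (Fin d) => ∫⁻ g, f (x + c + t • g)
      ∂(stdGaussian (EuclideanSpace ℝ (Fin d))) := hg.lintegral_prod_right'
  have hG2 : Measurable fun w : EuclideanSpace ℝ (Fin d) × S =>
      ∫⁻ g, f (w.1 + e + r • H w.2 w.1 + c + t • g)
        ∂(stdGaussian (EuclideanSpace ℝ (Fin d))) := hG.comp hstep
  rw [lintegral_map hf (by fun_prop), lintegral_prod _ hg.aemeasurable,
    lintegral_map hG hstep, lintegral_prod _ hG2.aemeasurable]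

/-- Replacing one step by a Gaussian one, with the trivial coupling. -/
theorem W2_step_le_trivial (h : IsotropicField Q H b) (e c : EuclideanSpace ℝ (Fin d))
    {δ : ℝ} (hδ : 0 ≤ δ) (m : ℕ) :
    W2 ((((ν.prod Q).map fun w => w.1 + e + √δ • H w.2 w.1).prod
          (stdGaussian (EuclideanSpace ℝ (Fin d)))).map fun w => w.1 + c + √(m * δ) • w.2)
        ((ν.prod (stdGaussian (EuclideanSpace ℝ (Fin d)))).map
          fun w => w.1 + (e + c) + √((m + 1 : ℕ) * δ) • w.2) ≤ ENNReal.ofReal (√δ * (2 * b)) := by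
  have hb := h.nonneg
  have hH := h.measurable
  set G := stdGaussian (EuclideanSpace ℝ (Fin d)) with hG
  -- Both endpoints share the position and the later noise, the last component; the sample and the
  -- first Gaussian drive the step being compared.
  set π := ν.prod (Q.prod (G.prod G)) with hπ
  have hHw : Measurable fun w : EuclideanSpace ℝ (Fin d) × S × EuclideanSpace ℝ (Fin d) ×
      EuclideanSpace ℝ (Fin d) => H w.2.1 w.1 :=
    hH.comp (by fun_prop : Measurable fun w : EuclideanSpace ℝ (Fin d) × S ×
      EuclideanSpace ℝ (Fin d) × EuclideanSpace ℝ (Fin d) => (w.2.1, w.1))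
  have hU : Measurable fun w : EuclideanSpace ℝ (Fin d) × S × EuclideanSpace ℝ (Fin d) ×
      EuclideanSpace ℝ (Fin d) => w.1 + e + √δ • H w.2.1 w.1 + c + √(m * δ) • w.2.2.2 := by
    fun_prop
  have hV : Measurable fun w : EuclideanSpace ℝ (Fin d) × S × EuclideanSpace ℝ (Fin d) ×
      EuclideanSpace ℝ (Fin d) => w.1 + (e + c) + √δ • w.2.2.1 + √(m * δ) • w.2.2.2 := by
    fun_prop
  have hπi : ∀ {f : EuclideanSpace ℝ (Fin d) × S × EuclideanSpace ℝ (Fin d) ×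
      EuclideanSpace ℝ (Fin d) → ℝ≥0∞}, Measurable f → ∫⁻ w, f w ∂π =
      ∫⁻ z, ∫⁻ s, ∫⁻ g, ∫⁻ g', f (z, s, g, g') ∂G ∂G ∂Q ∂ν := by
    intro f hf
    rw [hπ, lintegral_prod _ hf.aemeasurable]
    refine lintegral_congr fun z => ?_
    have h1 : Measurable fun y => f (z, y) := hf.comp measurable_prodMk_left
    rw [lintegral_prod _ h1.aemeasurable]
    refine lintegral_congr fun s => ?_
    have h2 : Measurable fun y => f (z, s, y) := h1.comp measurable_prodMk_left
    rw [lintegral_prod _ h2.aemeasurable]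
  have hlawU : π.map (fun w => w.1 + e + √δ • H w.2.1 w.1 + c + √(m * δ) • w.2.2.2) =
      ((((ν.prod Q).map fun w => w.1 + e + √δ • H w.2 w.1).prod G).map
        fun w => w.1 + c + √(m * δ) • w.2) := by
    refine Measure.ext_of_lintegral _ fun f hf => ?_
    rw [lintegral_map_step hH e c _ _ hf, lintegral_map hf hU, hπi (by exact hf.comp hU)]
    simp [hG]
  have hlawV : π.map (fun w => w.1 + (e + c) + √δ • w.2.2.1 + √(m * δ) • w.2.2.2) =
      (ν.prod G).map fun w => w.1 + (e + c) + √((m + 1 : ℕ) * δ) • w.2 := by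
    refine Measure.ext_of_lintegral _ fun f hf => ?_
    have hsq : √δ ^ 2 + √(m * δ) ^ 2 = √((m + 1 : ℕ) * δ) ^ 2 := by
      rw [Real.sq_sqrt hδ, Real.sq_sqrt (by positivity), Real.sq_sqrt (by positivity)]
      push_cast
      ring
    rw [lintegral_map_gaussian _ _ hf, lintegral_map hf hV, hπi (by exact hf.comp hV)]
    simp only [hG, lintegral_add_smul_add_smul_stdGaussian hsq hf]
    simp
  rw [← hlawU, ← hlawV]
  refine W2_map_le π hU hV (by positivity) ?_
  have hb2 : ∀ᵐ w ∂π, ‖H w.2.1 w.1‖ ≤ b := by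
    have h1 : ∀ᵐ w ∂π, ∀ u, ‖H w.2.1 u‖ ≤ b :=
      (Measure.quasiMeasurePreserving_fst.comp Measure.quasiMeasurePreserving_snd).ae h.bound
    exact h1.mono fun w hw => hw w.1
  have hpt : ∀ᵐ w ∂π, ‖w.1 + e + √δ • H w.2.1 w.1 + c + √(m * δ) • w.2.2.2 -
      (w.1 + (e + c) + √δ • w.2.2.1 + √(m * δ) • w.2.2.2)‖ₑ ^ 2 ≤
      ENNReal.ofReal (2 * δ * b ^ 2) + ENNReal.ofReal (2 * δ) * ‖w.2.2.1‖ₑ ^ 2 := by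
    filter_upwards [hb2] with w hw
    have e1 : w.1 + e + √δ • H w.2.1 w.1 + c + √(m * δ) • w.2.2.2 -
      (w.1 + (e + c) + √δ • w.2.2.1 + √(m * δ) • w.2.2.2) = √δ • (H w.2.1 w.1 - w.2.2.1) := by
      rw [smul_sub]; abel
    rw [e1, ← ofReal_norm, ← ofReal_norm, ← ENNReal.ofReal_pow (norm_nonneg _),
      ← ENNReal.ofReal_pow (norm_nonneg _), ← ENNReal.ofReal_mul (by positivity),
      ← ENNReal.ofReal_add (by positivity) (by positivity)]
    refine ENNReal.ofReal_le_ofReal ?_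
    rw [norm_smul, mul_pow, Real.norm_of_nonneg (Real.sqrt_nonneg _), Real.sq_sqrt hδ]
    have h1 : ‖H w.2.1 w.1 - w.2.2.1‖ ^ 2 ≤ 2 * b ^ 2 + 2 * ‖w.2.2.1‖ ^ 2 := by
      have h2 := norm_sub_le (H w.2.1 w.1) w.2.2.1
      have h3 : ‖H w.2.1 w.1 - w.2.2.1‖ ≤ b + ‖w.2.2.1‖ := by linarith
      have h4 := pow_le_pow_left₀ (norm_nonneg _) h3 2
      nlinarith [sq_nonneg (b - ‖w.2.2.1‖)]
    nlinarith [mul_le_mul_of_nonneg_left h1 hδ]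
  refine (lintegral_mono_ae hpt).trans ?_
  rw [hπi (by fun_prop)]
  have hg : ∫⁻ g : EuclideanSpace ℝ (Fin d), (ENNReal.ofReal (2 * δ * b ^ 2) +
      ENNReal.ofReal (2 * δ) * ‖g‖ₑ ^ 2) ∂G = ENNReal.ofReal (2 * δ * b ^ 2) +
      ENNReal.ofReal (2 * δ) * d := by
    rw [lintegral_add_left measurable_const, lintegral_const_mul _ (by fun_prop), hG,
      lintegral_enorm_sq_stdGaussian]
    simp
  simp only [lintegral_const, measure_univ, mul_one, hg]
  rw [← ENNReal.ofReal_natCast, ← ENNReal.ofReal_mul (by positivity),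
    ← ENNReal.ofReal_add (by positivity) (by positivity)]
  refine ENNReal.ofReal_le_ofReal ?_
  rw [mul_pow, Real.sq_sqrt hδ]
  -- With `d ≤ b ^ 2`, the cost `2 δ b ^ 2 + 2 δ d` is at most `(√δ * 2 b) ^ 2`.
  nlinarith [mul_le_mul_of_nonneg_left h.dim_le hδ]

/-- Replacing one step by a Gaussian one, after at least `2 b²` Gaussian steps have smoothed the
laws, with the coupling of the transport inequality. -/
theorem W2_step_le_smooth (h : IsotropicField Q H b) (hb : 1 ≤ b)
    (e c : EuclideanSpace ℝ (Fin d)) {δ : ℝ} (hδ : 0 ≤ δ) (m : ℕ)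
    (hm : 2 * b ^ 2 ≤ ((m + 1 : ℕ) : ℝ)) :
    W2 ((((ν.prod Q).map fun w => w.1 + e + √δ • H w.2 w.1).prod
          (stdGaussian (EuclideanSpace ℝ (Fin d)))).map fun w => w.1 + c + √(m * δ) • w.2)
        ((ν.prod (stdGaussian (EuclideanSpace ℝ (Fin d)))).map
          fun w => w.1 + (e + c) + √((m + 1 : ℕ) * δ) • w.2) ≤
      ENNReal.ofReal (√δ * (4 * b ^ 3 / (m + 1 : ℕ))) := by
  have hH := h.measurable
  have hb2 : 1 ≤ b ^ 2 := one_le_pow₀ hb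
  obtain ⟨τ, hτ⟩ : ∃ τ : ℝ, τ = ((m + 1 : ℕ) : ℝ) := ⟨_, rfl⟩
  rw [← hτ] at hm ⊢
  have hmτ : (m : ℝ) = τ - 1 := by rw [hτ]; push_cast; ring
  have hτ0 : 2 ≤ τ := by linarith
  -- The share of the replaced step in the total variance `τ δ`; the hypothesis `hm` says exactly `r
  -- b ^ 2 ≤ 1 / 2`.
  set r : ℝ := τ⁻¹ with hr
  have hr0 : 0 < r := by positivity
  have hτr : τ * r = 1 := by rw [hr]; field_simp
  have hrb : r * b ^ 2 ≤ 1 / 2 := by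
    rw [hr, inv_mul_le_iff₀ (by linarith)]; linarith
  have hr1 : r < 1 := by nlinarith
  obtain ⟨v, hv⟩ : ∃ v : NNReal, (v : ℝ) = 1 - r := ⟨⟨1 - r, by linarith⟩, rfl⟩
  have hv0 : v ≠ 0 := by
    rw [← NNReal.coe_ne_zero, hv]; linarith
  set A : EuclideanSpace ℝ (Fin d) → S → Fin d → ℝ := fun z s => √r • (H s z).ofLp with hA
  have hAj : Measurable fun w : EuclideanSpace ℝ (Fin d) × S => A w.1 w.2 := by
    have h1 : Measurable fun w : EuclideanSpace ℝ (Fin d) × S => H w.2 w.1 :=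
      hH.comp measurable_swap
    have h2 : Measurable fun w : EuclideanSpace ℝ (Fin d) × S => (H w.2 w.1).ofLp := by fun_prop
    exact h2.const_smul (√r)
  have hAm : ∀ z, Measurable (A z) := fun z => hAj.comp measurable_prodMk_left
  have hsum : ∀ z s, ∑ i, A z s i ^ 2 = r * ∑ i, (H s z) i ^ 2 := by
    intro z s
    rw [Finset.mul_sum]
    refine Finset.sum_congr rfl fun i _ => ?_
    simp only [hA, Pi.smul_apply, smul_eq_mul]
    rw [mul_pow, Real.sq_sqrt hr0.le]
  set p : EuclideanSpace ℝ (Fin d) → (Fin d → ℝ) → ℝ := fun z => mixPDF Q v (A z) with hp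
  have hpm : Measurable (Function.uncurry p) := by
    have h1 : Measurable fun w : (EuclideanSpace ℝ (Fin d) × (Fin d → ℝ)) × S =>
        gaussPDF v (A w.1.1 w.2) w.1.2 :=
      measurable_gaussPDF_comp v (hAj.comp (by fun_prop : Measurable
        fun w : (EuclideanSpace ℝ (Fin d) × (Fin d → ℝ)) × S => (w.1.1, w.2))) (by fun_prop)
    exact (StronglyMeasurable.integral_prod_right (ν := Q)
      (f := fun (w : EuclideanSpace ℝ (Fin d) × (Fin d → ℝ)) s => gaussPDF v (A w.1 s) w.2)
      h1.stronglyMeasurable).measurable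
  have hpt : ∀ z, TameDensity (p z) := fun z => tameDensity_mixPDF hv0 (hAm z) (B := r * b ^ 2)
    ((h.sum_sq_le z).mono fun s hs => by
      rw [hsum]; exact mul_le_mul_of_nonneg_left hs hr0.le)
  obtain ⟨T, hTm, hT⟩ := exists_knothe d p hpm hpt
  have hent : ∀ z, ∫ x, p z x * Real.log (p z x / stdPDF x) ≤ 5 * r ^ 3 * b ^ 6 := fun z =>
    integral_mul_log_le_of_lintegral_sq_div_le (hpt z)
      (lintegral_mixPDF_sq_div_le (X := fun s => (H s z).ofLp)
        (by have := h.measurable_apply z; fun_prop) hr0 hb hrb hv h.dim_le (h.sum_sq_le z)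
        (h.integral_coord z) (h.cov z))
  set γ₀ : Measure (Fin d → ℝ) := Measure.pi fun _ => gaussianReal 0 1 with hγ₀
  have hstd : stdGaussian (EuclideanSpace ℝ (Fin d)) = γ₀.map (WithLp.toLp 2) :=
    map_pi_eq_stdGaussian.symm
  -- Given the position `z`, the normalised endpoint `Y = √r H(z) + √(1 - r) g` is coupled with its
  -- image under the Knothe map `T z`, which is standard Gaussian for every `z`.
  set π := ν.prod (Q.prod γ₀) with hπ
  have hπi : ∀ {f : EuclideanSpace ℝ (Fin d) × S × (Fin d → ℝ) → ℝ≥0∞}, Measurable f →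
      ∫⁻ w, f w ∂π = ∫⁻ z, ∫⁻ s, ∫⁻ g, f (z, s, g) ∂γ₀ ∂Q ∂ν := by
    intro f hf
    rw [hπ, lintegral_prod _ hf.aemeasurable]
    refine lintegral_congr fun z => ?_
    have h1 : Measurable fun y => f (z, y) := hf.comp measurable_prodMk_left
    rw [lintegral_prod _ h1.aemeasurable]
  set Y : EuclideanSpace ℝ (Fin d) × S × (Fin d → ℝ) → Fin d → ℝ :=
    fun w => A w.1 w.2.1 + √(v : ℝ) • w.2.2 with hY
  have hYm : Measurable Y :=
    (hAj.comp (by fun_prop : Measurable fun w : EuclideanSpace ℝ (Fin d) × S × (Fin d → ℝ) =>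
      (w.1, w.2.1))).add ((by fun_prop : Measurable fun w : EuclideanSpace ℝ (Fin d) × S ×
        (Fin d → ℝ) => w.2.2).const_smul (√(v : ℝ)))
  have hTY : Measurable fun w : EuclideanSpace ℝ (Fin d) × S × (Fin d → ℝ) => T w.1 (Y w) :=
    hTm.comp (measurable_fst.prodMk hYm)
  have hTz : ∀ z, Measurable (T z) := fun z => hTm.comp measurable_prodMk_left
  -- integrating a function of `(z, Y)` amounts to integrating against the density of `Y`
  have hπY : ∀ {f : EuclideanSpace ℝ (Fin d) → (Fin d → ℝ) → ℝ≥0∞},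
      Measurable (Function.uncurry f) →
      ∫⁻ w, f w.1 (Y w) ∂π = ∫⁻ z, ∫⁻ x, ENNReal.ofReal (p z x) * f z x ∂volume ∂ν := by
    intro f hf
    rw [hπ, lintegral_prod _ (by exact (hf.comp (measurable_fst.prodMk hYm)).aemeasurable)]
    refine lintegral_congr fun z => ?_
    have hfz : Measurable (f z) := hf.comp measurable_prodMk_left
    rw [← lintegral_withDensity_ofReal (hpt z).continuous.measurable hfz,
      ← map_add_gaussian hv0 (hAm z), lintegral_map hfz]
    exact ((hAm z).comp measurable_fst).add (measurable_snd.const_smul (√(v : ℝ)))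
  have hHw : Measurable fun w : EuclideanSpace ℝ (Fin d) × S × (Fin d → ℝ) => H w.2.1 w.1 :=
    hH.comp (by fun_prop : Measurable fun w : EuclideanSpace ℝ (Fin d) × S × (Fin d → ℝ) =>
      (w.2.1, w.1))
  have hU : Measurable fun w : EuclideanSpace ℝ (Fin d) × S × (Fin d → ℝ) =>
      w.1 + e + √δ • H w.2.1 w.1 + c + √(m * δ) • WithLp.toLp 2 w.2.2 := by
    fun_prop
  have hV : Measurable fun w : EuclideanSpace ℝ (Fin d) × S × (Fin d → ℝ) =>
      w.1 + (e + c) + √(τ * δ) • WithLp.toLp 2 (T w.1 (Y w)) := by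
    fun_prop
  have hlawU : π.map (fun w => w.1 + e + √δ • H w.2.1 w.1 + c + √(m * δ) • WithLp.toLp 2 w.2.2) =
      ((((ν.prod Q).map fun w => w.1 + e + √δ • H w.2 w.1).prod
        (stdGaussian (EuclideanSpace ℝ (Fin d)))).map fun w => w.1 + c + √(m * δ) • w.2) := by
    refine Measure.ext_of_lintegral _ fun f hf => ?_
    rw [lintegral_map_step hH e c _ _ hf, lintegral_map hf hU, hπi (by exact hf.comp hU), hstd]
    refine lintegral_congr fun z => lintegral_congr fun s => ?_
    rw [lintegral_map (by fun_prop) (by fun_prop)]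
  have hlawV : π.map (fun w => w.1 + (e + c) + √(τ * δ) • WithLp.toLp 2 (T w.1 (Y w))) =
      (ν.prod (stdGaussian (EuclideanSpace ℝ (Fin d)))).map
        fun w => w.1 + (e + c) + √(τ * δ) • w.2 := by
    refine Measure.ext_of_lintegral _ fun f hf => ?_
    have hfm : Measurable (Function.uncurry fun (z : EuclideanSpace ℝ (Fin d)) (x : Fin d → ℝ) =>
        f (z + (e + c) + √(τ * δ) • WithLp.toLp 2 (T z x))) := by
      have : Measurable fun w : EuclideanSpace ℝ (Fin d) × (Fin d → ℝ) => T w.1 w.2 := hTm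
      unfold Function.uncurry
      fun_prop
    rw [lintegral_map_gaussian _ _ hf, lintegral_map hf hV, hπY hfm, hstd]
    refine lintegral_congr fun z => ?_
    have hfz : Measurable fun x : Fin d → ℝ => f (z + (e + c) + √(τ * δ) • WithLp.toLp 2 x) := by
      fun_prop
    rw [lintegral_map (by fun_prop) (by fun_prop), ← (hT z).1, lintegral_map hfz (hTz z),
      lintegral_withDensity_ofReal (hpt z).continuous.measurable (by exact hfz.comp (hTz z))]
  rw [← hlawU, ← hlawV]
  refine W2_map_le π hU hV (by positivity) ?_
  have hs1 : √(τ * δ) * √r = √δ := by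
    rw [← Real.sqrt_mul (by positivity), mul_right_comm, hτr, one_mul]
  have hs2 : √(τ * δ) * √(v : ℝ) = √(m * δ) := by
    rw [← Real.sqrt_mul (by positivity), hv, hmτ]
    congr 1
    linear_combination (-δ) * hτr
  have hcost : ∀ w : EuclideanSpace ℝ (Fin d) × S × (Fin d → ℝ),
      ‖w.1 + e + √δ • H w.2.1 w.1 + c + √(m * δ) • WithLp.toLp 2 w.2.2 -
        (w.1 + (e + c) + √(τ * δ) • WithLp.toLp 2 (T w.1 (Y w)))‖ₑ ^ 2 =
      ENNReal.ofReal (τ * δ) * ENNReal.ofReal (∑ i, (Y w i - T w.1 (Y w) i) ^ 2) := by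
    intro w
    have e1 : w.1 + e + √δ • H w.2.1 w.1 + c + √(m * δ) • WithLp.toLp 2 w.2.2 -
        (w.1 + (e + c) + √(τ * δ) • WithLp.toLp 2 (T w.1 (Y w))) =
        √(τ * δ) • WithLp.toLp 2 (Y w - T w.1 (Y w)) := by
      rw [← hs1, ← hs2]
      ext i
      simp only [hY, hA, PiLp.sub_apply, PiLp.add_apply, PiLp.smul_apply, Pi.sub_apply,
        Pi.add_apply, Pi.smul_apply, smul_eq_mul]
      ring
    rw [e1, ← ofReal_norm, ← ENNReal.ofReal_pow (norm_nonneg _), norm_smul, mul_pow,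
      Real.norm_of_nonneg (Real.sqrt_nonneg _), Real.sq_sqrt (by positivity),
      EuclideanSpace.real_norm_sq_eq, ENNReal.ofReal_mul (by positivity)]
    rfl
  have hcm : Measurable (Function.uncurry fun (z : EuclideanSpace ℝ (Fin d)) (x : Fin d → ℝ) =>
      ENNReal.ofReal (∑ i, (x i - T z x i) ^ 2)) := by
    have : Measurable fun w : EuclideanSpace ℝ (Fin d) × (Fin d → ℝ) => T w.1 w.2 := hTm
    unfold Function.uncurry
    fun_prop
  simp only [hcost]
  rw [lintegral_const_mul' _ _ ENNReal.ofReal_ne_top,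
    hπY (f := fun z x => ENNReal.ofReal (∑ i, (x i - T z x i) ^ 2)) hcm]
  have hz : ∀ z, ∫⁻ x, ENNReal.ofReal (p z x) * ENNReal.ofReal (∑ i, (x i - T z x i) ^ 2) ≤
      ENNReal.ofReal (10 * r ^ 3 * b ^ 6) := by
    intro z
    refine le_trans (le_of_eq (lintegral_congr fun x => ?_)) ((hT z).2.2.trans
      (ENNReal.ofReal_le_ofReal (by linarith [hent z])))
    rw [← ENNReal.ofReal_mul ((hpt z).pos x).le, mul_comm]
  refine (mul_le_mul' le_rfl (lintegral_mono hz)).trans ?_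
  rw [lintegral_const, measure_univ, mul_one, ← ENNReal.ofReal_mul (by positivity)]
  refine ENNReal.ofReal_le_ofReal ?_
  rw [mul_pow, Real.sq_sqrt hδ, div_eq_mul_inv, ← hr]
  -- Rescaling by `τ = 1 / r` costs one power of `r`; then `10 ≤ 4 ^ 2`.
  have e2 : τ * δ * (10 * r ^ 3 * b ^ 6) = 10 * (δ * r ^ 2 * b ^ 6) := by
    linear_combination (10 * δ * r ^ 2 * b ^ 6) * hτr
  have e3 : 0 ≤ δ * r ^ 2 * b ^ 6 := by positivity
  rw [e2]
  nlinarith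

/-- When `m + 1 ≤ 2 b ^ 2`, the trivial cost `2 b` is already at most `4 b ^ 3 / (m + 1)`, so one
bound covers all steps, including the last, where no noise follows. -/
theorem W2_step_le (h : IsotropicField Q H b) (hb : 1 ≤ b)
    (e c : EuclideanSpace ℝ (Fin d)) {δ : ℝ} (hδ : 0 ≤ δ) (m : ℕ) :
    W2 ((((ν.prod Q).map fun w => w.1 + e + √δ • H w.2 w.1).prod
          (stdGaussian (EuclideanSpace ℝ (Fin d)))).map fun w => w.1 + c + √(m * δ) • w.2)
        ((ν.prod (stdGaussian (EuclideanSpace ℝ (Fin d)))).map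
          fun w => w.1 + (e + c) + √((m + 1 : ℕ) * δ) • w.2) ≤
      ENNReal.ofReal (√δ * (4 * b ^ 3 / (m + 1 : ℕ))) := by
  rcases le_total (2 * b ^ 2) ((m + 1 : ℕ) : ℝ) with hm | hm
  · exact W2_step_le_smooth h hb e c hδ m hm
  · refine (W2_step_le_trivial h e c hδ m).trans (ENNReal.ofReal_le_ofReal ?_)
    refine mul_le_mul_of_nonneg_left ?_ (Real.sqrt_nonneg δ)
    have hm0 : (0 : ℝ) < (m + 1 : ℕ) := by positivity
    rw [le_div_iff₀ hm0]
    calc 2 * b * ((m + 1 : ℕ) : ℝ) ≤ 2 * b * (2 * b ^ 2) := by gcongr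
      _ = 4 * b ^ 3 := by ring

end OneStep

/-! ### Telescoping over the steps. -/

section Comparison

variable {d : ℕ} {Ω : Type*} [MeasurableSpace Ω] {P : Measure Ω} [IsProbabilityMeasure P]

/-- The law of the Gaussian walk after `k` steps. -/
theorem map_gaussian_walk {ζ : ℕ → Ω → EuclideanSpace ℝ (Fin d)} (hζ : iIndepFun ζ P)
    (hζG : ∀ k, HasLaw (ζ k) (stdGaussian (EuclideanSpace ℝ (Fin d))) P) {δ : ℝ} (hδ : 0 ≤ δ)
    (β z₀ : EuclideanSpace ℝ (Fin d)) (k : ℕ) :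
    P.map (fun ω => walk δ β z₀ (fun j _ => ζ j ω) k) =
      ((Measure.dirac z₀).prod (stdGaussian (EuclideanSpace ℝ (Fin d)))).map
        fun w => w.1 + (k * δ) • β + √(k * δ) • w.2 := by
  induction k with
  | zero =>
    have h1 : (fun ω => walk δ β z₀ (fun j _ => ζ j ω) 0) = fun _ => z₀ := rfl
    rw [h1, Measure.map_const, measure_univ, one_smul]
    simp only [Nat.cast_zero, zero_mul, Real.sqrt_zero, zero_smul, add_zero]
    exact (Measure.fst_prod (μ := Measure.dirac z₀)
      (ν := stdGaussian (EuclideanSpace ℝ (Fin d)))).symm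
  | succ k ih =>
    have hF : Measurable (Function.uncurry
        fun (g _ : EuclideanSpace ℝ (Fin d)) => g) := measurable_fst
    rw [(map_walk_succ hF hζ hζG δ β z₀ k).2, ih]
    refine Measure.ext_of_lintegral _ fun f hf => ?_
    have hsq : √(k * δ) ^ 2 + √δ ^ 2 = √((k + 1 : ℕ) * δ) ^ 2 := by
      rw [Real.sq_sqrt hδ, Real.sq_sqrt (by positivity), Real.sq_sqrt (by positivity)]
      push_cast
      ring
    rw [lintegral_map_step (H := fun g _ => g) hF _ _ _ _ hf, lintegral_map_gaussian _ _ hf]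
    refine lintegral_congr fun z => ?_
    rw [← lintegral_add_smul_add_smul_stdGaussian hsq hf]
    refine lintegral_congr fun g => lintegral_congr fun g' => ?_
    congr 1
    push_cast
    rw [add_mul, one_mul, add_smul]
    abel

/-- A walk driven by an isotropic bounded random field is close to the Gaussian walk: replace its
steps by Gaussian ones, one at a time and starting from the last. -/
theorem W2_walk_le {S : Type*} [MeasurableSpace S] {Q : Measure S} [IsProbabilityMeasure Q]
    {H : S → EuclideanSpace ℝ (Fin d) → EuclideanSpace ℝ (Fin d)} {b : ℝ}
    (h : IsotropicField Q H b) (hb : 1 ≤ b) {σ : ℕ → Ω → S} (hσ : iIndepFun σ P)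
    (hσQ : ∀ k, HasLaw (σ k) Q P) {ζ : ℕ → Ω → EuclideanSpace ℝ (Fin d)} (hζ : iIndepFun ζ P)
    (hζG : ∀ k, HasLaw (ζ k) (stdGaussian (EuclideanSpace ℝ (Fin d))) P) {δ : ℝ} (hδ : 0 ≤ δ)
    (β z₀ : EuclideanSpace ℝ (Fin d)) (K : ℕ) :
    W2 (P.map fun ω => walk δ β z₀ (fun k => H (σ k ω)) K)
        (P.map fun ω => walk δ β z₀ (fun k _ => ζ k ω) K) ≤
      ENNReal.ofReal (√δ * (4 * b ^ 3) * (harmonic K : ℚ)) := by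
  set ν : ℕ → Measure (EuclideanSpace ℝ (Fin d)) :=
    fun k => P.map fun ω => walk δ β z₀ (fun j => H (σ j ω)) k with hν
  have hνp : ∀ k, IsProbabilityMeasure (ν k) := fun k =>
    Measure.isProbabilityMeasure_map (map_walk_succ h.measurable hσ hσQ δ β z₀ k).1
  -- The interpolating laws, with the remaining `K - k` Gaussian steps merged into one. `M K` is the
  -- law of the field walk and `M 0` that of the Gaussian walk.
  set M : ℕ → Measure (EuclideanSpace ℝ (Fin d)) := fun k =>
    ((ν k).prod (stdGaussian (EuclideanSpace ℝ (Fin d)))).map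
      fun w => w.1 + ((K - k : ℕ) * δ) • β + √((K - k : ℕ) * δ) • w.2 with hM
  have hMp : ∀ k, IsProbabilityMeasure (M k) := fun k =>
    Measure.isProbabilityMeasure_map (by fun_prop)
  have hMK : M K = P.map fun ω => walk δ β z₀ (fun k => H (σ k ω)) K := by
    simp only [hM, Nat.sub_self, Nat.cast_zero, zero_mul, Real.sqrt_zero, zero_smul, add_zero]
    exact Measure.fst_prod (μ := ν K) (ν := stdGaussian (EuclideanSpace ℝ (Fin d)))
  have hM0 : M 0 = P.map fun ω => walk δ β z₀ (fun k _ => ζ k ω) K := by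
    have hν0 : ν 0 = Measure.dirac z₀ := by
      have h1 : (fun ω => walk δ β z₀ (fun j => H (σ j ω)) 0) = fun _ => z₀ := rfl
      rw [hν]
      simp only [h1, Measure.map_const, measure_univ, one_smul]
    rw [map_gaussian_walk hζ hζG hδ]
    simp only [hM, hν0, Nat.sub_zero]
  rw [← hMK, ← hM0]
  have hstep : ∀ k < K, W2 (M (k + 1)) (M k) ≤
      ENNReal.ofReal (√δ * (4 * b ^ 3) * ((K - k : ℕ) : ℝ)⁻¹) := by
    intro k hk
    obtain ⟨m, hm⟩ : ∃ m, K - k = m + 1 := ⟨K - (k + 1), by omega⟩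
    have hm' : K - (k + 1) = m := by omega
    have := hνp k
    have h1 := W2_step_le (ν := ν k) h hb (δ • β) ((m * δ) • β) hδ m
    have h2 : δ • β + (m * δ) • β = ((m + 1 : ℕ) * δ) • β := by
      rw [← add_smul]
      congr 1
      push_cast
      ring
    rw [h2] at h1
    simp only [hM, hm, hm']
    have h3 : ν (k + 1) = ((ν k).prod Q).map fun w => w.1 + δ • β + √δ • H w.2 w.1 :=
      (map_walk_succ h.measurable hσ hσQ δ β z₀ k).2
    rw [h3]
    refine h1.trans (le_of_eq ?_)
    congr 1
    rw [div_eq_mul_inv, mul_assoc, mul_assoc, mul_assoc]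
  refine (W2_chain_le M (fun k => √δ * (4 * b ^ 3) * ((K - k : ℕ) : ℝ)⁻¹)
    (fun k => by positivity) K hstep).trans (le_of_eq ?_)
  rw [← Finset.mul_sum]
  congr 2
  rw [harmonic, Rat.cast_sum, ← Finset.sum_range_reflect]
  refine Finset.sum_congr rfl fun k hk => ?_
  have : K - (K - 1 - k) = k + 1 := by
    have := Finset.mem_range.1 hk
    omega
  rw [this, Rat.cast_inv, Rat.cast_natCast]

end Comparison

/-! ### The logarithmic factor and the conclusion. -/

/-- The harmonic number of `T⁻²` is at most a multiple of `log (1 / (T b²))⁴`. -/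
theorem harmonic_le_mul_log_pow {T b : ℝ} (hT : 0 < T) (hb : 1 ≤ b) (hTb : 16 * b ^ 2 * T ≤ 1)
    {K : ℕ} (hK : (K : ℝ) = T / T ^ 3) :
    (harmonic K : ℝ) ≤ (3 + 2 * b ^ 2) * Real.log (1 / (T * b ^ 2)) ^ 4 := by
  have hb0 : 0 < b ^ 2 := by positivity
  have hTb0 : 0 < T * b ^ 2 := by positivity
  have hl : Real.log (1 / (T * b ^ 2)) = -Real.log T - Real.log (b ^ 2) := by
    rw [one_div, Real.log_inv, Real.log_mul hT.ne' hb0.ne']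
    ring
  have hlK : Real.log K = -2 * Real.log T := by
    rw [hK, Real.log_div hT.ne' (by positivity), Real.log_pow]
    push_cast
    ring
  set l := Real.log (1 / (T * b ^ 2)) with hldef
  -- The bound on `T` gives `1 / (T b ^ 2) ≥ 16 > e`. Hence constants can be absorbed into `l`, and
  -- `l` into its fourth power.
  have hl1 : 1 ≤ l := by
    rw [hldef, Real.le_log_iff_exp_le (by positivity), le_div_iff₀ hTb0]
    have := Real.exp_one_lt_d9
    nlinarith
  have hlb : Real.log (b ^ 2) ≤ b ^ 2 - 1 := Real.log_le_sub_one_of_pos hb0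
  have hl4 : l ≤ l ^ 4 := le_self_pow₀ hl1 (by norm_num)
  calc (harmonic K : ℝ) ≤ 1 + Real.log K := harmonic_le_one_add_log K
    _ = 1 + 2 * (l + Real.log (b ^ 2)) := by rw [hlK, hl]; ring
    _ ≤ (3 + 2 * b ^ 2) * l := by nlinarith
    _ ≤ (3 + 2 * b ^ 2) * l ^ 4 := by gcongr

end

theorem lemmal :
    -- `lam` is one universal polynomial: it is chosen before the dimension and all other data
    ∃ lam : MvPolynomial (Fin 4) ℝ,
    ∀ (d : ℕ)
      -- the random field: `H s u` for a random sample `s` drawn from `Q`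
      {S : Type*} [MeasurableSpace S] (Q : Measure S) [IsProbabilityMeasure Q]
      (H : S → EuclideanSpace ℝ (Fin d) → EuclideanSpace ℝ (Fin d))
      (_ : Measurable (Function.uncurry H))
      (LH LH' LH'' LR Lβ : ℝ) (_ : 0 < LR)
      (_ : ∀ᵐ s ∂Q, ∀ u, ‖H s u‖ ≤ LH)
      (_ : ∀ᵐ s ∂Q, ∀ u, ‖u‖ ≤ 1 / √LR →
        DifferentiableAt ℝ (H s) u ∧ DifferentiableAt ℝ (fderiv ℝ (H s)) u ∧
        ‖fderiv ℝ (H s) u‖ ≤ LH' ∧ ‖fderiv ℝ (fderiv ℝ (H s)) u‖ ≤ LH'')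
      (_ : ∀ u, ∫ s, H s u ∂Q = 0)
      (_ : ∀ u i j, ∫ s, H s u i * H s u j ∂Q = if i = j then 1 else 0)
      -- the independent samples `H_k = H (σ k)` and the independent standard Gaussians `ζ k`
      {Ω : Type*} [MeasurableSpace Ω] (P : Measure Ω) [IsProbabilityMeasure P]
      (σ : ℕ → Ω → S) (_ : iIndepFun σ P) (_ : ∀ k, HasLaw (σ k) Q P)
      (ζ : ℕ → Ω → EuclideanSpace ℝ (Fin d)) (_ : iIndepFun ζ P)
      (_ : ∀ k, HasLaw (ζ k) (stdGaussian (EuclideanSpace ℝ (Fin d))) P)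
      -- the drift and the common starting point
      (β z₀ : EuclideanSpace ℝ (Fin d)) (_ : ‖β‖ ≤ Lβ)
      -- the upper bounds on `T`, with the denominators cleared
      (T δ : ℝ) (K : ℕ) (_ : 0 < T)
      (_ : 16 * LH ^ 2 * T ≤ 1)
      (_ : 16 * LH' ^ 2 * T ≤ 1)
      (_ : 32 * √LR * Lβ * T ≤ 1)
      (_ : 128 * LR * LH ^ 2 * T ≤ 1)
      (_ : 256 * LR * LH ^ 2 * Real.log (2 ^ 10 * LR) * T ≤ 1)
      (_ : δ = T ^ 3) (_ : (K : ℝ) = T / δ),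
      W2 (P.map fun ω => walk δ β z₀ (fun k => H (σ k ω)) K)
          (P.map fun ω => walk δ β z₀ (fun k _ => ζ (k + 1) ω) K)
        ≤ ENNReal.ofReal
            (MvPolynomial.eval ![LH, LH', LH'', LR] lam
              * Real.log (1 / (T * LH ^ 2)) ^ 4 * T ^ (3 / 2 : ℝ)) := by
  -- The factor `4 b ^ 3` is the one-step constant, and `3 + 2 b ^ 2` comes from the harmonic sum.
  refine ⟨MvPolynomial.C 4 * MvPolynomial.X 0 ^ 3 *
    (MvPolynomial.C 3 + MvPolynomial.C 2 * MvPolynomial.X 0 ^ 2), ?_⟩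
  intro d S _ Q _ H hH LH LH' LH'' LR Lβ _ hbound _ hmean hcov Ω _ P _ σ hσ hσQ ζ hζ hζG β z₀ _
    T δ K hT hTLH _ _ _ _ hδ hK
  -- In dimension zero the walks coincide; this case is separate because `1 ≤ LH` needs a positive
  -- dimension.
  rcases Nat.eq_zero_or_pos d with rfl | hd
  · have heq : (fun ω => walk δ β z₀ (fun k => H (σ k ω)) K) =
        fun ω => walk δ β z₀ (fun k _ => ζ (k + 1) ω) K := funext fun ω => Subsingleton.elim _ _
    rw [heq, W2_self]
    exact zero_le
  have h : IsotropicField Q H LH := ⟨hH, hbound, hmean, hcov⟩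
  have hb : 1 ≤ LH := h.one_le hd.ne'
  rw [hδ] at hK
  have hδ0 : 0 ≤ δ := by rw [hδ]; positivity
  -- The Gaussian walk uses `ζ` shifted by one; an injective reindexing preserves independence.
  refine (W2_walk_le h hb hσ hσQ (ζ := fun k => ζ (k + 1))
    (hζ.precomp (add_left_injective 1)) (fun k => hζG (k + 1)) hδ0 β z₀ K).trans
    (ENNReal.ofReal_le_ofReal ?_)
  have hsqrt : √δ = T ^ (3 / 2 : ℝ) := by
    rw [hδ, Real.sqrt_eq_rpow, ← Real.rpow_natCast, ← Real.rpow_mul hT.le]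
    norm_num
  have heval : MvPolynomial.eval ![LH, LH', LH'', LR] (MvPolynomial.C 4 * MvPolynomial.X 0 ^ 3 *
      (MvPolynomial.C 3 + MvPolynomial.C 2 * MvPolynomial.X 0 ^ 2)) =
      4 * LH ^ 3 * (3 + 2 * LH ^ 2) := by
    simp
  have hT0 : 0 ≤ T ^ (3 / 2 : ℝ) := Real.rpow_nonneg hT.le _
  rw [heval, hsqrt]
  calc T ^ (3 / 2 : ℝ) * (4 * LH ^ 3) * (harmonic K : ℚ)
      ≤ T ^ (3 / 2 : ℝ) * (4 * LH ^ 3) *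
        ((3 + 2 * LH ^ 2) * Real.log (1 / (T * LH ^ 2)) ^ 4) := by
        gcongr
        exact harmonic_le_mul_log_pow hT hb hTLH hK
    _ = _ := by ring
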